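/- Let $a\neq 0$ and $\mu=2M>0$, and let $G(r)=1-\frac{\mu}{r^2}+\frac{\mu a^2}{r^4}$. On the 3-sphere with Euler angles $(\theta,\phi,\psi)$, $0<\theta<\pi$, let $\bar\sigma_1,\bar\sigma_2,\bar\sigma_3$ be the vector fields $$\bar\sigma_1=2(-\sin\phi\,\partial_\theta-\cot\theta\cos\phi\,\partial_\phi+\csc\theta\cos\phi\,\partial_\psi),\quad \bar\sigma_2=2(-\cos\phi\,\partial_\theta+\cot\theta\sin\phi\,\partial_\phi-\csc\theta\sin\phi\,\partial_\psi),\quad \bar\sigma_3=2\partial_\phi,$$ let $\bar\sigma^i$ be the dual covectors (so $d\bar\sigma^i=-\epsilon^i{}_{jk}\,\bar\sigma^j\wedge\bar\sigma^k$), and let $\bar\sigma^\pm=\frac1{\sqrt2}(\bar\sigma^1\pm i\bar\sigma^2)$. The 5-dimensional Myers–Perry metric with equal angular momenta is $$g=-dt^2+\frac{dr^2}{G(r)}+r^2\{\bar\sigma^+\bar\sigma^-+\bar\sigma^-\bar\sigma^++(\bar\sigma^3)^2\}+\frac{\mu}{r^2}(dt-a\bar\sigma^3)^2,$$ with Killing–Yano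 3-form $f=-a r\,dt\wedge dr\wedge\bar\sigma^3-i r^2\,\bar\sigma^+\wedge\bar\sigma^-\wedge(-a\,dt+r^2\bar\sigma^3)$. The symmetry operator $\mathcal S$ sends a symmetric 2-tensor $h$ to $Z=\mathcal Sh$, $$Z_{\lambda\rho}=2f_{(\lambda}{}^{\kappa\tau}\nabla_{|\kappa|}h_{\rho)\tau}=f_{\lambda}{}^{\kappa\tau}\nabla_{\kappa}h_{\rho\tau}+f_{\rho}{}^{\kappa\tau}\nabla_{\kappa}h_{\lambda\tau}.$$ Let $U\subseteq\mathbb R^2$ be an open set of values of $(t,r)$ on which $r>0$ and $G(r)\ne0$. Let $h$ be a smooth real perturbation over $U$ in the $(J,K,M)=(0,1,0)$ mode, that is $$h=2h_{A+}(t,r)\,\bar\sigma^A\bar\sigma^++2h_{A-}(t,r)\,\bar\sigma^A\bar\sigma^-,\qquad A\in\{t,r,3\},\ h_{A-}=h_{A+}^*,$$ with $\bar\sigma^t=dt$, $\bar\sigma^r=dr$ and symmetric products $\bar\sigma^A\bar\sigma^\pm=\frac12(\bar\sigma^A\otimes\bar\sigma^\pm+\bar\sigma^\pm\otimes\bar\sigma^A)$.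 Suppose that $h$ satisfies the vacuum Einstein equation linearized at $g$. For a tensor in this mode set $$f_t=\frac1{r^2}\Big(h_{t+}+\frac{i r^4}{2\mu a^2}\partial_t h_{+3}+\frac1a h_{+3}\Big),\qquad f_r=\frac1{r^2}\Big(h_{r+}+\frac{i r^2}{2\mu a^2}\partial_r(r^2h_{+3})\Big),$$ $$\pi_r=r^5\Big(1+\frac{\mu a^2}{r^4}\Big)(\partial_tf_r-\partial_rf_t)-2i\mu a\,r f_r,\qquad \Phi_1=\frac{(1+\frac{\mu a^2}{r^4})^{1/4}}{r^{5/2}\big(1+\frac{\mu a^2}{r^4}+\frac{\mu^2a^6}{4r^{10}}\big)^{1/2}}\,\pi_r .$$ Then $Z=\mathcal Sh$ is again a real tensor in the $(0,1,0)$ mode over $U$, and its master variable $\Phi_1^Z$, defined by the same formulas with $Z$ in place of $h$, satisfies on $U$ $$\Phi_1^Z=(i a\,\partial_t+6)\,\Phi_1 .$$ In particular, if $\Phi_1(t,r)=e^{-i\omega t}\varphi(r)$ with $\omega=\omega_{\rm Re}+i\omega_{\rm Im}\in\mathbb C$, then $$\Phi_1^Z=(a\omega+6)\,\Phi_1=\Big\{(a\omega_{\rm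 Re}+6)\,e^{-i\omega_{\rm Re}t}+a\,\omega_{\rm Im}\,e^{-i(\omega_{\rm Re}t-\pi/2)}\Big\}e^{\omega_{\rm Im}t}\,\varphi(r).$$ -/

import Mathlib

noncomputable section

namespace MyersPerry

open scoped ContDiff

/-- Coordinate space with coordinates `(t, r, θ, φ, ψ)` numbered `0, 1, 2, 3, 4`; here `r` is the
radial coordinate `r̃` and `(θ, φ, ψ)` are the Euler angles `(θ̃, φ̃, ψ̃)` of the 3-sphere. -/
abbrev Coord : Type := Fin 5 → ℝ

/-- The part of the chart lying over a set `U` of values of `(t, r)`. -/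
def chart (U : Set (ℝ × ℝ)) : Set Coord :=
  {x | (x 0, x 1) ∈ U ∧ 0 < x 2 ∧ x 2 < Real.pi}

/-- Partial derivative of a complex function with respect to the `n`-th coordinate. -/
def pd (n : Fin 5) (F : Coord → ℂ) (x : Coord) : ℂ :=
  fderiv ℝ F x (Pi.single n 1)

/-- Coordinate components of the vector field `σ̄₁ = 2 σ₁`. -/
def sbar1 (x : Coord) : Fin 5 → ℝ :=
  ![0, 0, -2 * Real.sin (x 3),
    -2 * (Real.cos (x 2) / Real.sin (x 2)) * Real.cos (x 3),
    2 * (1 / Real.sin (x 2)) * Real.cos (x 3)]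

/-- Coordinate components of the vector field `σ̄₂ = 2 σ₂`. -/
def sbar2 (x : Coord) : Fin 5 → ℝ :=
  ![0, 0, -2 * Real.cos (x 3),
    2 * (Real.cos (x 2) / Real.sin (x 2)) * Real.sin (x 3),
    -2 * (1 / Real.sin (x 2)) * Real.sin (x 3)]

/-- Coordinate components of the (complex) frame `(∂_t, ∂_r, σ̄₊, σ̄₋, σ̄₃)`, numbered
`0, 1, 2, 3, 4`, where `σ̄_± = (σ̄₁ ∓ i σ̄₂) / √2` and `σ̄₃ = 2 ∂_φ`.
All tensor components below refer to this frame. -/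
def frameVec (i : Fin 5) (x : Coord) : Fin 5 → ℂ :=
  match i with
  | 0 => ![1, 0, 0, 0, 0]
  | 1 => ![0, 1, 0, 0, 0]
  | 2 => fun m => ((sbar1 x m : ℂ) - Complex.I * (sbar2 x m : ℂ)) / (Real.sqrt 2 : ℂ)
  | 3 => fun m => ((sbar1 x m : ℂ) + Complex.I * (sbar2 x m : ℂ)) / (Real.sqrt 2 : ℂ)
  | 4 => ![0, 0, 0, 2, 0]

/-- The `i`-th frame vector acting on a function. -/
def frameD (i : Fin 5) (F : Coord → ℂ) (x : Coord) : ℂ :=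
  ∑ m, frameVec i x m * pd m F x

/-- Structure coefficients `c^k_{ij}` of the frame, `[e_i, e_j] = ∑ k, c^k_{ij} e_k`
(see `frame_bracket`). -/
def structC : Fin 5 → Fin 5 → Fin 5 → ℂ
  | 4, 2, 3 => 2 * Complex.I
  | 4, 3, 2 => -2 * Complex.I
  | 2, 4, 2 => 2 * Complex.I
  | 2, 2, 4 => -2 * Complex.I
  | 3, 4, 3 => -2 * Complex.I
  | 3, 3, 4 => 2 * Complex.I
  | _, _, _ => 0

lemma pd_prod {f g : ℝ → ℂ} {f' g' : ℂ} {x : Coord} (n : Fin 5)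
    (hf : HasDerivAt f f' (x 2)) (hg : HasDerivAt g g' (x 3)) :
    pd n (fun y => f (y 2) * g (y 3)) x
      = (if n = 2 then f' * g (x 3) else 0) + (if n = 3 then f (x 2) * g' else 0) := by
  have h2 : HasFDerivAt (fun y : Coord => y 2)
      (ContinuousLinearMap.proj (R := ℝ) (φ := fun _ : Fin 5 => ℝ) 2) x :=
    (ContinuousLinearMap.proj (R := ℝ) (φ := fun _ : Fin 5 => ℝ) 2).hasFDerivAt
  have h3 : HasFDerivAt (fun y : Coord => y 3)
      (ContinuousLinearMap.proj (R := ℝ) (φ := fun _ : Fin 5 => ℝ) 3) x :=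
    (ContinuousLinearMap.proj (R := ℝ) (φ := fun _ : Fin 5 => ℝ) 3).hasFDerivAt
  have H := (hf.hasFDerivAt.comp x h2).mul (hg.hasFDerivAt.comp x h3)
  have H' : fderiv ℝ (fun y : Coord => f (y 2) * g (y 3)) x = _ := H.fderiv
  unfold pd
  rw [H']
  fin_cases n <;> simp
  ring

lemma pd_frameVec (n j m : Fin 5) (x : Coord) (hx : Real.sin (x 2) ≠ 0) :
    pd n (fun y => frameVec j y m) x =
      match j with
      | 2 => (![0, 0,
          if n = 3 then -2 * (Real.cos (x 3) : ℂ) - 2 * Complex.I * Real.sin (x 3) else 0,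
          (if n = 2 then (2 / (Real.sin (x 2) : ℂ) ^ 2)
              * (Real.cos (x 3) + Complex.I * Real.sin (x 3)) else 0)
            + (if n = 3 then -2 * ((Real.cos (x 2) : ℂ) / Real.sin (x 2))
              * (-Real.sin (x 3) + Complex.I * Real.cos (x 3)) else 0),
          (if n = 2 then (-2 * (Real.cos (x 2) : ℂ) / (Real.sin (x 2) : ℂ) ^ 2)
              * (Real.cos (x 3) + Complex.I * Real.sin (x 3)) else 0)
            + (if n = 3 then 2 / (Real.sin (x 2) : ℂ)
              * (-Real.sin (x 3) + Complex.I * Real.cos (x 3)) else 0)] m : ℂ)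
              / (Real.sqrt 2 : ℂ)
      | 3 => (![0, 0,
          if n = 3 then -2 * (Real.cos (x 3) : ℂ) + 2 * Complex.I * Real.sin (x 3) else 0,
          (if n = 2 then (2 / (Real.sin (x 2) : ℂ) ^ 2)
              * (Real.cos (x 3) - Complex.I * Real.sin (x 3)) else 0)
            + (if n = 3 then -2 * ((Real.cos (x 2) : ℂ) / Real.sin (x 2))
              * (-Real.sin (x 3) - Complex.I * Real.cos (x 3)) else 0),
          (if n = 2 then (-2 * (Real.cos (x 2) : ℂ) / (Real.sin (x 2) : ℂ) ^ 2)
              * (Real.cos (x 3) - Complex.I * Real.sin (x 3)) else 0)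
            + (if n = 3 then 2 / (Real.sin (x 2) : ℂ)
              * (-Real.sin (x 3) - Complex.I * Real.cos (x 3)) else 0)] m : ℂ)
              / (Real.sqrt 2 : ℂ)
      | _ => 0 := by
  have hs : (Real.sin (x 2) : ℂ) ≠ 0 := by exact_mod_cast hx
  have h2 : (Real.sqrt 2 : ℂ) ≠ 0 := by
    exact_mod_cast (Real.sqrt_pos.mpr (by norm_num : (0 : ℝ) < 2)).ne'
  have hcs : (Real.cos (x 2) : ℂ) ^ 2 = 1 - (Real.sin (x 2) : ℂ) ^ 2 := by
    have := Real.sin_sq_add_cos_sq (x 2)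
    rw [eq_sub_iff_add_eq, add_comm]
    exact_mod_cast this
  have dsin : ∀ s : ℝ, HasDerivAt (fun s : ℝ => (Real.sin s : ℂ)) (Real.cos s : ℂ) s :=
    fun s => (Real.hasDerivAt_sin s).ofReal_comp
  have dcos : ∀ s : ℝ, HasDerivAt (fun s : ℝ => (Real.cos s : ℂ)) (-Real.sin s : ℂ) s :=
    fun s => by simpa using (Real.hasDerivAt_cos s).ofReal_comp
  have d1 : HasDerivAt (fun _ : ℝ => (1 : ℂ)) 0 (x 2) := hasDerivAt_const _ _
  have dcot := (dcos (x 2)).div (dsin (x 2)) hs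
  have dcsc := (hasDerivAt_const (x 2) (1 : ℂ)).div (dsin (x 2)) hs
  have c0 : ∀ c : ℂ, pd n (fun _ => c) x = 0 := fun c => by simp [pd]
  have e : ∀ ε : ℂ, HasDerivAt
      (fun s : ℝ => ((Real.cos s : ℂ) + ε * (Real.sin s : ℂ)) / (Real.sqrt 2 : ℂ))
      ((-Real.sin (x 3) + ε * Real.cos (x 3)) / (Real.sqrt 2 : ℂ)) (x 3) := fun ε =>
    ((dcos (x 3)).add ((dsin (x 3)).const_mul ε)).div_const _
  have e' : ∀ ε : ℂ, HasDerivAt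
      (fun s : ℝ => ((Real.sin s : ℂ) + ε * (Real.cos s : ℂ)) / (Real.sqrt 2 : ℂ))
      ((Real.cos (x 3) + ε * (-Real.sin (x 3))) / (Real.sqrt 2 : ℂ)) (x 3) := fun ε =>
    ((dsin (x 3)).add ((dcos (x 3)).const_mul ε)).div_const _
  have P2 := fun ε : ℂ => pd_prod n d1 ((e' ε).const_mul (-2))
  have P3 := fun ε : ℂ => pd_prod n dcot ((e ε).const_mul (-2))
  have P4 := fun ε : ℂ => pd_prod n dcsc ((e ε).const_mul 2)
  have S : ∀ (A B : Coord → ℂ) (c : ℂ), (∀ y, A y = B y) → pd n B x = c → pd n A x = c := by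
    intro A B c hAB hB
    rw [show A = B from funext hAB, hB]
  fin_cases j
  · exact c0 _
  · exact c0 _
  · fin_cases m
    · refine S _ (fun _ => 0) _ (fun y => ?_) ((c0 0).trans ?_) <;> simp [frameVec, sbar1, sbar2]
    · refine S _ (fun _ => 0) _ (fun y => ?_) ((c0 0).trans ?_) <;> simp [frameVec, sbar1, sbar2]
    · refine S _ _ _ (fun y => ?_) ((P2 (-Complex.I)).trans ?_)
      · simp [frameVec, sbar1, sbar2]; ring
      · simp; split_ifs <;> ring
    · refine S _ _ _ (fun y => ?_) ((P3 Complex.I).trans ?_)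
      · simp [frameVec, sbar1, sbar2]; ring
      · simp only [Pi.div_apply, neg_mul, mul_neg, ← sq, hcs]
        simp; split_ifs <;> ring
    · refine S _ _ _ (fun y => ?_) ((P4 Complex.I).trans ?_)
      · simp [frameVec, sbar1, sbar2]; ring
      · simp; split_ifs <;> ring
  · fin_cases m
    · refine S _ (fun _ => 0) _ (fun y => ?_) ((c0 0).trans ?_) <;> simp [frameVec, sbar1, sbar2]
    · refine S _ (fun _ => 0) _ (fun y => ?_) ((c0 0).trans ?_) <;> simp [frameVec, sbar1, sbar2]
    · refine S _ _ _ (fun y => ?_) ((P2 Complex.I).trans ?_)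
      · simp [frameVec, sbar1, sbar2]; ring
      · simp; split_ifs <;> ring
    · refine S _ _ _ (fun y => ?_) ((P3 (-Complex.I)).trans ?_)
      · simp [frameVec, sbar1, sbar2]; ring
      · simp only [Pi.div_apply, neg_mul, mul_neg, ← sq, hcs]
        simp; split_ifs <;> ring
    · refine S _ _ _ (fun y => ?_) ((P4 (-Complex.I)).trans ?_)
      · simp [frameVec, sbar1, sbar2]; ring
      · simp; split_ifs <;> ring
  · exact c0 _

set_option maxHeartbeats 1000000 in
lemma frame_bracket_aux (m : Fin 5) (x : Coord) (hx : Real.sin (x 2) ≠ 0) (i j : Fin 5)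
    (hij : (i = 2 ∧ j = 3) ∨ (i = 2 ∧ j = 4) ∨ (i = 3 ∧ j = 4)) :
    frameD i (fun y => frameVec j y m) x - frameD j (fun y => frameVec i y m) x
      = ∑ k, structC k i j * frameVec k x m := by
  have hs : (Real.sin (x 2) : ℂ) ≠ 0 := by exact_mod_cast hx
  have hI : Complex.I ^ 2 = -1 := Complex.I_sq
  have hr : (Real.sqrt 2 : ℂ) ^ 2 = 2 := by
    exact_mod_cast Real.sq_sqrt (by norm_num : (0 : ℝ) ≤ 2)
  have h2 : (Real.sqrt 2 : ℂ) ≠ 0 := by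
    exact_mod_cast (Real.sqrt_pos.mpr (by norm_num : (0 : ℝ) < 2)).ne'
  have hc2 : (Real.cos (x 2) : ℂ) ^ 2 = 1 - (Real.sin (x 2) : ℂ) ^ 2 := by
    have := Real.sin_sq_add_cos_sq (x 2)
    rw [eq_sub_iff_add_eq, add_comm]
    exact_mod_cast this
  have hc3 : (Real.cos (x 3) : ℂ) ^ 2 = 1 - (Real.sin (x 3) : ℂ) ^ 2 := by
    have := Real.sin_sq_add_cos_sq (x 3)
    rw [eq_sub_iff_add_eq, add_comm]
    exact_mod_cast this
  simp only [frameD, pd_frameVec _ _ _ _ hx, Fin.sum_univ_five]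
  generalize hS : (Real.sqrt 2 : ℂ) = S at *
  rcases hij with ⟨rfl, rfl⟩ | ⟨rfl, rfl⟩ | ⟨rfl, rfl⟩ <;> fin_cases m <;>
    simp [frameVec, sbar1, sbar2, structC, -Complex.ofReal_sin, -Complex.ofReal_cos, hS] <;>
    generalize (Real.sin (x 2) : ℂ) = s2 at * <;>
    generalize (Real.cos (x 2) : ℂ) = c2 at * <;>
    generalize (Real.sin (x 3) : ℂ) = s3 at * <;>
    generalize (Real.cos (x 3) : ℂ) = c3 at * <;>
    field_simp <;> grind

lemma structC_antisymm (k i j : Fin 5) : structC k i j = -structC k j i := by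
  fin_cases k <;> fin_cases i <;> fin_cases j <;> simp [structC]

/-- The structure coefficients are those of the Lie brackets of the frame vector fields. -/
theorem frame_bracket (i j m : Fin 5) (x : Coord) (hx : Real.sin (x 2) ≠ 0) :
    frameD i (fun y => frameVec j y m) x - frameD j (fun y => frameVec i y m) x
      = ∑ k, structC k i j * frameVec k x m := by
  have key := frame_bracket_aux m x hx
  wlog hij : i < j generalizing i j with H
  · rcases eq_or_lt_of_le (not_lt.mp hij) with rfl | hlt
    · have h0 : ∀ k, structC k j j = 0 := fun k => by
        have := structC_antisymm k j j
        linear_combination (1 / 2) * this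
      simp [h0]
    · have := H j i hlt
      rw [← neg_sub, this, ← Finset.sum_neg_distrib]
      exact Finset.sum_congr rfl fun k _ => by rw [structC_antisymm k i j]; ring
  · by_cases h : (i = 2 ∧ j = 3) ∨ (i = 2 ∧ j = 4) ∨ (i = 3 ∧ j = 4)
    · exact key i j h
    · have h1 : i = 0 ∨ i = 1 := by omega
      have hz : ∀ k, structC k i j = 0 := fun k => by
        rcases h1 with rfl | rfl <;> fin_cases k <;> fin_cases j <;> simp [structC]
      rw [show ∑ k, structC k i j * frameVec k x m = 0 by simp [hz]]
      simp only [frameD, pd_frameVec _ _ _ _ hx, Fin.sum_univ_five]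
      rcases h1 with rfl | rfl <;> fin_cases j <;> fin_cases m <;> simp [frameVec]

/-- The metric function `G(r) = 1 - μ/r² + μ a²/r⁴`. -/
def G (a μ r : ℝ) : ℝ := 1 - μ / r ^ 2 + μ * a ^ 2 / r ^ 4

/-- Frame components of the metric
`-dt² + dr²/G + r² ((σ̄⁺σ̄⁻ + σ̄⁻σ̄⁺) + (σ̄³)²) + (μ/r²) (dt - a σ̄³)²`, with `μ = 2M`. -/
def metric (a μ : ℝ) (x : Coord) : Matrix (Fin 5) (Fin 5) ℂ :=
  let r : ℝ := x 1
  !![((-1 + μ / r ^ 2 : ℝ) : ℂ), 0, 0, 0, ((-(μ * a / r ^ 2) : ℝ) : ℂ);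
    0, ((1 / G a μ r : ℝ) : ℂ), 0, 0, 0;
    0, 0, 0, ((r ^ 2 : ℝ) : ℂ), 0;
    0, 0, ((r ^ 2 : ℝ) : ℂ), 0, 0;
    ((-(μ * a / r ^ 2) : ℝ) : ℂ), 0, 0, 0, ((r ^ 2 + μ * a ^ 2 / r ^ 2 : ℝ) : ℂ)]

/-- Frame components of the inverse metric. -/
def invMetric (a μ : ℝ) (x : Coord) : Matrix (Fin 5) (Fin 5) ℂ := (metric a μ x)⁻¹

/-- Levi-Civita connection coefficients `Γ^k_{ij} = e^k (∇_{e_i} e_j)` (Koszul formula). -/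
def conn (a μ : ℝ) (k i j : Fin 5) (x : Coord) : ℂ :=
  (1 / 2) * ∑ s, invMetric a μ x k s *
    (frameD i (fun y => metric a μ y j s) x + frameD j (fun y => metric a μ y i s) x
      - frameD s (fun y => metric a μ y i j) x
      + ∑ l, (structC l i j * metric a μ x l s - structC l i s * metric a μ x l j
        - structC l j s * metric a μ x l i))

/-- Frame components of covariant tensor fields of rank 2. -/
abbrev Tensor2 : Type := Fin 5 → Fin 5 → Coord → ℂ

/-- Frame components of covariant tensor fields of rank 3. -/
abbrev Tensor3 : Type := Fin 5 → Fin 5 → Fin 5 → Coord → ℂ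

/-- `cov2 a μ h k i j = ∇_k h_{ij}`. -/
def cov2 (a μ : ℝ) (h : Tensor2) : Tensor3 := fun k i j x =>
  frameD k (h i j) x - ∑ l, conn a μ l k i x * h l j x - ∑ l, conn a μ l k j x * h i l x

/-- `cov3 a μ T k p i j = ∇_k T_{pij}`. -/
def cov3 (a μ : ℝ) (T : Tensor3) (k p i j : Fin 5) (x : Coord) : ℂ :=
  frameD k (T p i j) x - ∑ l, conn a μ l k p x * T l i j x
    - ∑ l, conn a μ l k i x * T p l j x - ∑ l, conn a μ l k j x * T p i l x

/-- The linearized Ricci tensor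
`½ g^{αβ} (∇_α ∇_i h_{jβ} + ∇_α ∇_j h_{iβ} - ∇_α ∇_β h_{ij} - ∇_i ∇_j h_{αβ})`. -/
def linRicci (a μ : ℝ) (h : Tensor2) : Tensor2 := fun i j x =>
  (1 / 2) * ∑ α, ∑ β, invMetric a μ x α β *
    (cov3 a μ (cov2 a μ h) α i j β x + cov3 a μ (cov2 a μ h) α j i β x
      - cov3 a μ (cov2 a μ h) α β i j x - cov3 a μ (cov2 a μ h) i j α β x)

/-- `h` solves the linearized vacuum Einstein equation over `U`. -/
def IsLinearVacuum (a μ : ℝ) (U : Set (ℝ × ℝ)) (h : Tensor2) : Prop :=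
  ∀ x ∈ chart U, ∀ i j, linRicci a μ h i j x = 0

/-- Frame components of the 3-form `e^p ∧ e^q ∧ e^s` built from the dual coframe. -/
def wedge3 (p q s i j k : Fin 5) : ℂ :=
  Matrix.det !![if p = i then (1 : ℂ) else 0, if p = j then 1 else 0, if p = k then 1 else 0;
    if q = i then 1 else 0, if q = j then 1 else 0, if q = k then 1 else 0;
    if s = i then 1 else 0, if s = j then 1 else 0, if s = k then 1 else 0]

/-- The Killing-Yano 3-form
`-a r dt ∧ dr ∧ σ̄³ - i r² σ̄⁺ ∧ σ̄⁻ ∧ (-a dt + r² σ̄³)`. -/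
def killingYano (a : ℝ) : Tensor3 := fun i j k x =>
  -(a : ℂ) * (x 1 : ℂ) * wedge3 0 1 4 i j k
    - Complex.I * (x 1 : ℂ) ^ 2 *
      (-(a : ℂ) * wedge3 2 3 0 i j k + (x 1 : ℂ) ^ 2 * wedge3 2 3 4 i j k)

/-- `f_i^{kl}`: the Killing-Yano 3-form with its last two indices raised. -/
def killingYanoUp (a μ : ℝ) (i k l : Fin 5) (x : Coord) : ℂ :=
  ∑ α, ∑ β, invMetric a μ x k α * invMetric a μ x l β * killingYano a i α β x

/-- The symmetry operator `Z_{ij} = 2 f_{(i}^{kl} ∇_{|k|} h_{j)l}`. -/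
def symOp (a μ : ℝ) (h : Tensor2) : Tensor2 := fun i j x =>
  ∑ k, ∑ l, (killingYanoUp a μ i k l x * cov2 a μ h k j l x
    + killingYanoUp a μ j k l x * cov2 a μ h k i l x)

/-- The tensor `2 h_{A+} σ̄^A σ̄⁺ + 2 h_{A-} σ̄^A σ̄⁻` (`A ∈ {t, r, 3}`, symmetric products) at a
point, with `(h_{t+}, h_{r+}, h_{3+}) = (u, v, w)` and `h_{A-}` the complex conjugate of
`h_{A+}`. -/
def modeMatrix (u v w : ℂ) : Matrix (Fin 5) (Fin 5) ℂ :=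
  !![0, 0, u, star u, 0;
    0, 0, v, star v, 0;
    u, v, 0, 0, w;
    star u, star v, 0, 0, star w;
    0, 0, w, star w, 0]

/-- `h` is a (smooth, real) `(J, K, M) = (0, 1, 0)` mode over `U`: it has the form
`2 h_{A+}(t, r) σ̄^A σ̄⁺ + 2 h_{A-}(t, r) σ̄^A σ̄⁻` with `h_{A-}` conjugate to `h_{A+}`. -/
def IsMode010 (U : Set (ℝ × ℝ)) (h : Tensor2) : Prop :=
  ∃ u v w : ℝ × ℝ → ℂ, ContDiffOn ℝ ∞ u U ∧ ContDiffOn ℝ ∞ v U ∧ ContDiffOn ℝ ∞ w U ∧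
    ∀ x ∈ chart U, ∀ i j,
      h i j x = modeMatrix (u (x 0, x 1)) (v (x 0, x 1)) (w (x 0, x 1)) i j

/-- The gauge-invariant variable `f_t`. -/
def gaugeT (a μ : ℝ) (h : Tensor2) (x : Coord) : ℂ :=
  (1 / (x 1 : ℂ) ^ 2) * (h 0 2 x
    + Complex.I * (x 1 : ℂ) ^ 4 / (2 * μ * a ^ 2) * pd 0 (h 2 4) x + (1 / (a : ℂ)) * h 2 4 x)

/-- The gauge-invariant variable `f_r`. -/
def gaugeR (a μ : ℝ) (h : Tensor2) (x : Coord) : ℂ :=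
  (1 / (x 1 : ℂ) ^ 2) * (h 1 2 x
    + Complex.I * (x 1 : ℂ) ^ 2 / (2 * μ * a ^ 2)
      * pd 1 (fun y => (y 1 : ℂ) ^ 2 * h 2 4 y) x)

/-- `π_r = r⁵ (1 + μa²/r⁴) (∂_t f_r - ∂_r f_t) - 2 i μ a r f_r`. -/
def momentum (a μ : ℝ) (h : Tensor2) (x : Coord) : ℂ :=
  (x 1 : ℂ) ^ 5 * (1 + μ * a ^ 2 / (x 1 : ℂ) ^ 4)
      * (pd 0 (gaugeR a μ h) x - pd 1 (gaugeT a μ h) x)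
    - 2 * Complex.I * μ * a * (x 1 : ℂ) * gaugeR a μ h x

/-- The factor relating `Φ₁` and `π_r`:
`(1 + μa²/r⁴)^{1/4} / (r^{5/2} (1 + μa²/r⁴ + μ²a⁶/(4r¹⁰))^{1/2})`. -/
def masterFactor (a μ r : ℝ) : ℝ :=
  (1 + μ * a ^ 2 / r ^ 4) ^ (1 / 4 : ℝ) /
    (r ^ (5 / 2 : ℝ) *
      (1 + μ * a ^ 2 / r ^ 4 + μ ^ 2 * a ^ 6 / (4 * r ^ 10)) ^ (1 / 2 : ℝ))

/-- The master variable `Φ₁` of a tensor in the `(0, 1, 0)` mode. -/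
def master (a μ : ℝ) (h : Tensor2) (x : Coord) : ℂ :=
  (masterFactor a μ (x 1) : ℂ) * momentum a μ h x

end MyersPerry

end

/-! The metric, the Killing–Yano form and a mode perturbation have frame components that depend on
`(t, r)` alone, and the structure coefficients of the frame are constants. The three frame vectors
tangent to the sphere therefore differentiate nothing, and all tensor calculus takes place in a
commutative algebra with two commuting derivations. With `s = 1/r` and `q = 1/(r⁴G)` adjoined, every
claim becomes a polynomial identity modulo a few relations; `Background` axiomatizes this.

The indices `σ̄⁺`, `σ̄⁻` carry charges `1`, `-1`, and both the connection and the contraction with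
the Killing–Yano form preserve charge. Hence `Z` is again a mode, with explicit components
(`sym_modeTensor`). Trading `(h_{t+}, h_{r+}, h_{3+})` for `(f_t, f_r, h_{3+})`, an invertible
change, makes `h_{3+}` disappear from the gauge-invariant variables of `Z` (`fieldT_sym`,
`fieldR_sym`). The momentum of `Z` is then `(i a ∂_t + 6) π_r` plus a remainder (`mom_sym`), and
this remainder is `-a r²` times twice the `(+, 3)` component of the linearized Ricci tensor
(`twoRicci_ofField`, `mom_symmetry`), which vanishes for a solution. Since the factor from `π_r` to
`Φ₁` depends on `r` only, it commutes with `∂_t`, and the same relation holds for `Φ₁`.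

The closed formulas used for the connection and the Killing–Yano contraction are justified by
`koszul` and `raise_raise_yano`; the predicate `Rep` carries the algebra back to the chart. -/

noncomputable section

namespace MyersPerry

open scoped ContDiff Topology
open TopologicalSpace (Opens)

/-! ### The differential algebra of smooth functions on `U`. -/

variable {U : Opens (ℝ × ℝ)}

/-- Extension by zero of a function on `U`. -/
def extZero (f : U → ℂ) : ℝ × ℝ → ℂ := Function.extend Subtype.val f 0

lemma extZero_apply (f : U → ℂ) {p : ℝ × ℝ} (hp : p ∈ U) : extZero f p = f ⟨p, hp⟩ :=
  Subtype.val_injective.extend_apply f 0 ⟨p, hp⟩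

lemma contDiffOn_extZero_congr {f : U → ℂ} {F : ℝ × ℝ → ℂ} (hF : ContDiffOn ℝ ∞ F U)
    (h : ∀ p : U, f p = F p) : ContDiffOn ℝ ∞ (extZero f) U :=
  hF.congr fun p hp => by rw [extZero_apply f hp, h]

/-- The algebra of smooth complex functions on `U`. -/
def smoothFn (U : Opens (ℝ × ℝ)) : Subalgebra ℂ (U → ℂ) where
  carrier := {f | ContDiffOn ℝ ∞ (extZero f) U}
  mul_mem' {f g} hf hg := contDiffOn_extZero_congr (ContDiffOn.mul hf hg) fun p => by
    simp [extZero_apply _ p.2]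
  add_mem' {f g} hf hg := contDiffOn_extZero_congr (ContDiffOn.add hf hg) fun p => by
    simp [extZero_apply _ p.2]
  algebraMap_mem' c := contDiffOn_extZero_congr (contDiffOn_const (c := c)) fun p => rfl

namespace smoothFn

/-- Restriction to `U` of a function smooth on `U`. -/
def of (F : ℝ × ℝ → ℂ) (hF : ContDiffOn ℝ ∞ F U) : smoothFn U :=
  ⟨fun p => F p, contDiffOn_extZero_congr hF fun _ => rfl⟩

/-- Openness of `U` makes the values outside irrelevant to the germ at a point of `U`, so
derivatives of the zero extension may be computed from any formula valid on `U`. -/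
lemma ext_of (f : smoothFn U) {F : ℝ × ℝ → ℂ} (h : ∀ p : U, f.1 p = F p) (p : U) :
    extZero f.1 =ᶠ[𝓝 (p : ℝ × ℝ)] F := by
  filter_upwards [U.2.mem_nhds p.2] with q hq
  rw [extZero_apply f.1 hq, h]

lemma differentiableAt (f : smoothFn U) (p : U) : DifferentiableAt ℝ (extZero f.1) p :=
  ((f.2.contDiffAt (U.2.mem_nhds p.2)).differentiableAt (by simp))

lemma contDiffOn_fderiv {F : ℝ × ℝ → ℂ} (hF : ContDiffOn ℝ ∞ F U) (e : ℝ × ℝ) :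
    ContDiffOn ℝ ∞ (fun p => fderiv ℝ F p e) U :=
  (hF.fderiv_of_isOpen U.2 (m := ∞) (by simp)).clm_apply contDiffOn_const

/-- The derivative in the direction `e` of `ℝ × ℝ`. -/
def der (e : ℝ × ℝ) : Derivation ℂ (smoothFn U) (smoothFn U) :=
  Derivation.mk'
    { toFun := fun f => of (fun p => fderiv ℝ (extZero f.1) p e) (contDiffOn_fderiv f.2 e)
      map_add' := fun f g => by
        ext p
        have h : extZero (f.1 + g.1) =ᶠ[𝓝 (p : ℝ × ℝ)] extZero f.1 + extZero g.1 :=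
          ext_of (f + g) (fun q => by simp [extZero_apply _ q.2]) p
        simp [of, h.fderiv_eq, fderiv_add (differentiableAt f p) (differentiableAt g p)]
      map_smul' := fun c f => by
        ext p
        have h : extZero (c • f.1) =ᶠ[𝓝 (p : ℝ × ℝ)] c • extZero f.1 :=
          ext_of (c • f) (fun q => by simp [extZero_apply _ q.2]) p
        simp [of, h.fderiv_eq, fderiv_const_smul (differentiableAt f p)] }
    fun f g => by
      ext p
      have h : extZero (f.1 * g.1) =ᶠ[𝓝 (p : ℝ × ℝ)] extZero f.1 * extZero g.1 :=
        ext_of (f * g) (fun q => by simp [extZero_apply _ q.2]) p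
      simp [of, h.fderiv_eq, fderiv_mul (differentiableAt f p) (differentiableAt g p),
        extZero_apply _ p.2]

lemma der_apply (e : ℝ × ℝ) (f : smoothFn U) (p : U) :
    (der e f).1 p = fderiv ℝ (extZero f.1) p e := rfl

lemma der_apply_of_eq {e : ℝ × ℝ} (f : smoothFn U) {F : ℝ × ℝ → ℂ} (h : ∀ p : U, f.1 p = F p)
    (p : U) : (der e f).1 p = fderiv ℝ F p e := by
  rw [der_apply, (ext_of f h p).fderiv_eq]

/-- Symmetry of the second Fréchet derivative. -/
lemma der_comm (e e' : ℝ × ℝ) (f : smoothFn U) : der e (der e' f) = der e' (der e f) := by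
  ext p
  have hf : ContDiffAt ℝ ∞ (extZero f.1) p := f.2.contDiffAt (U.2.mem_nhds p.2)
  have hd : DifferentiableAt ℝ (fderiv ℝ (extZero f.1)) p :=
    (hf.fderiv_right (m := 1) (by norm_cast)).differentiableAt (by simp)
  have key : ∀ v w : ℝ × ℝ, (der v (der w f)).1 p
      = fderiv ℝ (fderiv ℝ (extZero f.1)) p v w := fun v w => by
    rw [der_apply_of_eq (der w f) (F := fun q => fderiv ℝ (extZero f.1) q w) (fun q => rfl) p,
      fderiv_clm_apply hd (differentiableAt_const w)]
    simp
  have hs : IsSymmSndFDerivAt ℝ (extZero f.1) (p : ℝ × ℝ) :=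
    hf.isSymmSndFDerivAt (by
    simpa using WithTop.coe_le_coe.2 (le_top : (2 : ℕ∞) ≤ ⊤))
  rw [key, key]
  exact hs.eq e e'

/-- Pointwise complex conjugation. -/
def conj (f : smoothFn U) : smoothFn U :=
  of (fun p => star (extZero f.1 p)) ((starL' ℝ : ℂ ≃L[ℝ] ℂ).contDiff.comp_contDiffOn f.2)

lemma conj_apply (f : smoothFn U) (p : U) : (conj f).1 p = star (f.1 p) := by
  simp [conj, of, extZero_apply _ p.2]

lemma der_conj (e : ℝ × ℝ) (f : smoothFn U) : der e (conj f) = conj (der e f) := by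
  ext p
  rw [conj_apply, der_apply_of_eq (conj f) (F := fun q => star (extZero f.1 q)) (fun q => rfl) p,
    fderiv_star]
  rfl

/-- The coordinate `r`. -/
def r : smoothFn U := of (fun p => (p.2 : ℂ)) (Complex.ofRealCLM.contDiff.comp contDiff_snd).contDiffOn

lemma r_apply (p : U) : (r : smoothFn U).1 p = (p.1.2 : ℂ) := rfl

lemma fderiv_snd_ofReal (p e : ℝ × ℝ) : fderiv ℝ (fun p : ℝ × ℝ => (p.2 : ℂ)) p e = e.2 := by
  have h := (Complex.ofRealCLM.hasFDerivAt (x := p.2)).comp p (hasFDerivAt_snd (p := p))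
  have h' : fderiv ℝ (fun p : ℝ × ℝ => (p.2 : ℂ)) p = _ := h.fderiv
  rw [h']; simp

lemma der_r (e : ℝ × ℝ) : der e (r : smoothFn U) = algebraMap ℂ _ (e.2 : ℂ) := by
  ext p
  rw [der_apply_of_eq r (F := fun p => (p.2 : ℂ)) (fun q => rfl) p, fderiv_snd_ofReal]
  rfl

/-- The inverse of a nowhere vanishing function. -/
def inv (f : smoothFn U) (hf : ∀ p, f.1 p ≠ 0) : smoothFn U :=
  of (fun p => (extZero f.1 p)⁻¹) (f.2.inv fun p hp => by
    rw [extZero_apply f.1 hp]; exact hf _)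

lemma inv_apply (f : smoothFn U) (hf : ∀ p, f.1 p ≠ 0) (p : U) : (inv f hf).1 p = (f.1 p)⁻¹ := by
  simp [inv, of, extZero_apply _ p.2]

lemma mul_inv (f : smoothFn U) (hf : ∀ p, f.1 p ≠ 0) : f * inv f hf = 1 := by
  ext p
  simp [inv_apply, hf]

end smoothFn

open smoothFn

/-! ### Functions on the chart that depend on `(t, r)` only. -/

lemma isOpen_chart (U : Opens (ℝ × ℝ)) : IsOpen (chart U) := by
  have h : Continuous fun x : Coord => (x 0, x 1) := by fun_prop
  exact (U.2.preimage h).inter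
    ((isOpen_lt continuous_const (continuous_apply 2)).inter
      (isOpen_lt (continuous_apply 2) continuous_const))

/-- `F` is the pull-back of `f` to the chart over `U`. -/
def Rep (F : Coord → ℂ) (f : smoothFn U) : Prop :=
  ∀ x (hx : x ∈ chart U), F x = f.1 ⟨(x 0, x 1), hx.1⟩

/-- The frame vector fields acting on functions of `(t, r)`. -/
def frameA (i : Fin 5) : Derivation ℂ (smoothFn U) (smoothFn U) :=
  match i with
  | 0 => der (1, 0)
  | 1 => der (0, 1)
  | 2 => 0
  | 3 => 0
  | 4 => 0

namespace Rep

variable {F F' : Coord → ℂ} {f f' : smoothFn U}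

lemma of_eq (h : Rep F f) (e : f = f') : Rep F f' := e ▸ h

lemma congr (h : Rep F f) (e : ∀ x ∈ chart U, F' x = F x) : Rep F' f :=
  fun x hx => (e x hx).trans (h x hx)

lemma const (c : ℂ) : Rep (fun _ => c) (algebraMap ℂ (smoothFn U) c) := fun _ _ => rfl

lemma zero : Rep (fun _ => 0) (0 : smoothFn U) := fun _ _ => rfl

lemma add (h : Rep F f) (h' : Rep F' f') : Rep (fun x => F x + F' x) (f + f') :=
  fun x hx => congrArg₂ (· + ·) (h x hx) (h' x hx)

lemma sub (h : Rep F f) (h' : Rep F' f') : Rep (fun x => F x - F' x) (f - f') :=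
  fun x hx => congrArg₂ (· - ·) (h x hx) (h' x hx)

lemma mul (h : Rep F f) (h' : Rep F' f') : Rep (fun x => F x * F' x) (f * f') :=
  fun x hx => congrArg₂ (· * ·) (h x hx) (h' x hx)

lemma sum {ι : Type*} (s : Finset ι) {F : ι → Coord → ℂ} {f : ι → smoothFn U}
    (h : ∀ i ∈ s, Rep (F i) (f i)) : Rep (fun x => ∑ i ∈ s, F i x) (∑ i ∈ s, f i) := by
  classical
  induction s using Finset.induction_on with
  | empty => simpa using zero
  | insert i s hi ih =>
    simp only [Finset.sum_insert hi]
    exact (h i (by simp)).add (ih fun j hj => h j (by simp [hj]))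

lemma radius : Rep (fun x => (x 1 : ℂ)) (r : smoothFn U) := fun _ _ => rfl

lemma eventuallyEq (h : Rep F f) {x : Coord} (hx : x ∈ chart U) :
    F =ᶠ[𝓝 x] fun y => extZero f.1 (y 0, y 1) := by
  filter_upwards [(isOpen_chart U).mem_nhds hx] with y hy
  rw [h y hy, extZero_apply f.1 hy.1]

lemma hasFDerivAt (h : Rep F f) {x : Coord} (hx : x ∈ chart U) :
    HasFDerivAt F ((fderiv ℝ (extZero f.1) (x 0, x 1)).comp
      ((ContinuousLinearMap.proj (R := ℝ) (φ := fun _ : Fin 5 => ℝ) 0).prod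
        (ContinuousLinearMap.proj (R := ℝ) (φ := fun _ : Fin 5 => ℝ) 1))) x := by
  have h1 := (differentiableAt f ⟨(x 0, x 1), hx.1⟩).hasFDerivAt
  have h2 := ((ContinuousLinearMap.proj (R := ℝ) (φ := fun _ : Fin 5 => ℝ) 0).prod
    (ContinuousLinearMap.proj (R := ℝ) (φ := fun _ : Fin 5 => ℝ) 1)).hasFDerivAt (x := x)
  exact (HasFDerivAt.comp x h1 h2).congr_of_eventuallyEq (h.eventuallyEq hx)

lemma pd (h : Rep F f) (n : Fin 5) : Rep (pd n F) (frameA n f) := fun x hx => by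
  rw [MyersPerry.pd, (h.hasFDerivAt hx).fderiv]
  fin_cases n <;> simp [frameA, der_apply, Prod.mk_zero_zero]

/-- The fields `σ̄_±`, `σ̄₃` involve only angular derivatives, which kill functions of `(t, r)`. -/
lemma frameD (h : Rep F f) (i : Fin 5) : Rep (frameD i F) (frameA i f) := fun x hx => by
  have hpd := fun n => h.pd n x hx
  rw [MyersPerry.frameD, Fin.sum_univ_five]
  fin_cases i <;> simp [frameVec, hpd, frameA, sbar1, sbar2]

end Rep

end MyersPerry

/-! ### Algebraic model of the Myers–Perry geometry. -/

namespace MyersPerry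

/-- A commutative algebra with commuting derivations `dt`, `dr` containing the coefficients of the
Myers-Perry geometry: `s = 1/r`, `q = 1/(r⁴ G)`, `b = 1/a`, `κ = i/(2μa²)`, `m = μ`. -/
structure Background (A : Type*) [CommRing A] [Algebra ℂ A] where
  (r s q a b m κ i : A)
  (dt dr : Derivation ℂ A A)
  dt_r : dt r = 0
  dr_r : dr r = 1
  rs : r * s = 1
  pq : (r ^ 4 - m * r ^ 2 + m * a ^ 2) * q = 1
  ab : a * b = 1
  hκ : 2 * m * a ^ 2 * κ = i
  ii : i ^ 2 = -1
  const : ∀ c ∈ [a, b, m, κ, i], dt c = 0 ∧ dr c = 0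
  comm : ∀ x, dr (dt x) = dt (dr x)

namespace Background

variable {A : Type*} [CommRing A] [Algebra ℂ A] (B : Background A)

@[simp] lemma dt_a : B.dt B.a = 0 := (B.const _ (by simp)).1
@[simp] lemma dt_b : B.dt B.b = 0 := (B.const _ (by simp)).1
@[simp] lemma dt_m : B.dt B.m = 0 := (B.const _ (by simp)).1
@[simp] lemma dt_κ : B.dt B.κ = 0 := (B.const _ (by simp)).1
@[simp] lemma dt_i : B.dt B.i = 0 := (B.const _ (by simp)).1
@[simp] lemma dr_a : B.dr B.a = 0 := (B.const _ (by simp)).2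
@[simp] lemma dr_b : B.dr B.b = 0 := (B.const _ (by simp)).2
@[simp] lemma dr_m : B.dr B.m = 0 := (B.const _ (by simp)).2
@[simp] lemma dr_κ : B.dr B.κ = 0 := (B.const _ (by simp)).2
@[simp] lemma dr_i : B.dr B.i = 0 := (B.const _ (by simp)).2

attribute [simp] dt_r dr_r

/-- Leibniz applied to `x * y = 1`; this determines the derivatives of `s` and `q` from their
defining relations. -/
lemma derivation_inv (D : Derivation ℂ A A) {x y : A} (h : x * y = 1) :
    D y = -(y ^ 2 * D x) := by
  have h1 : D (x * y) = 0 := by rw [h]; exact D.map_one_eq_zero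
  rw [Derivation.leibniz, smul_eq_mul, smul_eq_mul] at h1
  linear_combination (y * h1 - D y * h)

lemma derivation_ofNat (D : Derivation ℂ A A) (n : ℕ) [n.AtLeastTwo] :
    D (ofNat(n) : A) = 0 := by
  rw [← Nat.cast_ofNat (R := A)]; exact D.map_natCast _

@[simp] lemma dt_s : B.dt B.s = 0 := by simp [derivation_inv _ B.rs]
@[simp] lemma dr_s : B.dr B.s = -B.s ^ 2 := by simp [derivation_inv _ B.rs]
@[simp] lemma dt_q : B.dt B.q = 0 := by
  simp [derivation_inv _ B.pq, Derivation.leibniz, Derivation.leibniz_pow]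
@[simp] lemma dr_q : B.dr B.q = -(B.q ^ 2 * (4 * B.r ^ 3 - 2 * B.m * B.r)) := by
  simp [derivation_inv _ B.pq, Derivation.leibniz, Derivation.leibniz_pow]; ring

/-- The frame vector fields on functions of `(t, r)`. -/
def frame (k : Fin 5) : Derivation ℂ A A :=
  match k with
  | 0 => B.dt
  | 1 => B.dr
  | 2 => 0
  | 3 => 0
  | 4 => 0

/-- The sum `∑ l, Γ^l_{ki} X l`. -/
def connSum (k i : Fin 5) (X : Fin 5 → A) : A :=
  match k, i with
  | 0, 0 => (B.m ^ 2 * B.a ^ 2 * B.s ^ 7 - B.m ^ 2 * B.s ^ 5 + B.m * B.s ^ 3) * X 1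
  | 0, 1 => B.m * B.r * B.q * X 0 + B.m * B.a * B.s * B.q * X 4
  | 0, 2 => B.i * B.m * B.a * B.s ^ 4 * X 2
  | 0, 3 => -B.i * B.m * B.a * B.s ^ 4 * X 3
  | 0, 4 => (-B.m ^ 2 * B.a ^ 3 * B.s ^ 7 + B.m ^ 2 * B.a * B.s ^ 5 - B.m * B.a * B.s ^ 3) * X 1
  | 1, 0 => B.m * B.r * B.q * X 0 + B.m * B.a * B.s * B.q * X 4
  | 1, 1 => (B.m * B.r * B.q - 2 * B.r ^ 3 * B.q + 2 * B.s) * X 1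
  | 1, 2 => B.s * X 2
  | 1, 3 => B.s * X 3
  | 1, 4 => -2 * B.m * B.a * B.r * B.q * X 0
      + (-2 * B.m * B.r * B.q + 2 * B.r ^ 3 * B.q - B.s) * X 4
  | 2, 0 => B.i * B.m * B.a * B.s ^ 4 * X 2
  | 2, 1 => B.s * X 2
  | 2, 2 => 0
  | 2, 3 => (-B.m * B.a ^ 2 * B.s ^ 3 + B.m * B.s - B.r) * X 1 + B.i * X 4
  | 2, 4 => (-B.i * B.m * B.a ^ 2 * B.s ^ 4 - B.i) * X 2
  | 3, 0 => -B.i * B.m * B.a * B.s ^ 4 * X 3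
  | 3, 1 => B.s * X 3
  | 3, 2 => (-B.m * B.a ^ 2 * B.s ^ 3 + B.m * B.s - B.r) * X 1 - B.i * X 4
  | 3, 3 => 0
  | 3, 4 => (B.i * B.m * B.a ^ 2 * B.s ^ 4 + B.i) * X 3
  | 4, 0 => (-B.m ^ 2 * B.a ^ 3 * B.s ^ 7 + B.m ^ 2 * B.a * B.s ^ 5 - B.m * B.a * B.s ^ 3) * X 1
  | 4, 1 => -2 * B.m * B.a * B.r * B.q * X 0
      + (-2 * B.m * B.r * B.q + 2 * B.r ^ 3 * B.q - B.s) * X 4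
  | 4, 2 => (-B.i * B.m * B.a ^ 2 * B.s ^ 4 + B.i) * X 2
  | 4, 3 => (B.i * B.m * B.a ^ 2 * B.s ^ 4 - B.i) * X 3
  | 4, 4 => (B.m ^ 2 * B.a ^ 4 * B.s ^ 7 - B.m ^ 2 * B.a ^ 2 * B.s ^ 5 + B.m * B.s - B.r) * X 1

/-- The trace `∑ k l, g^{kl} X k l`. -/
def trace (X : Fin 5 → Fin 5 → A) : A :=
  (-B.m * B.a ^ 2 * B.q - B.r ^ 4 * B.q) * X 0 0 - B.m * B.a * B.q * (X 0 4 + X 4 0)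
    + (B.m * B.a ^ 2 * B.s ^ 4 - B.m * B.s ^ 2 + 1) * X 1 1 + B.s ^ 2 * (X 2 3 + X 3 2)
    + (B.r ^ 2 * B.q - B.m * B.q) * X 4 4

/-- The contraction `∑ k l, f_i^{kl} X k l` with the Killing-Yano form. -/
def yanoSum (i : Fin 5) (X : Fin 5 → Fin 5 → A) : A :=
  match i with
  | 0 => -B.m * B.a ^ 2 * B.s ^ 3 * (X 0 1 - X 1 0)
      + (B.m * B.a * B.s ^ 3 - B.a * B.s) * (X 1 4 - X 4 1)
      - B.i * B.a * B.s ^ 2 * (X 2 3 - X 3 2)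
  | 1 => -B.a * B.r ^ 3 * B.q * (X 0 4 - X 4 0)
  | 2 => B.i * B.a * (X 0 2 - X 2 0) - B.i * (X 2 4 - X 4 2)
  | 3 => -B.i * B.a * (X 0 3 - X 3 0) + B.i * (X 3 4 - X 4 3)
  | 4 => (B.m * B.a ^ 3 * B.s ^ 3 + B.a * B.r) * (X 0 1 - X 1 0)
      - B.m * B.a ^ 2 * B.s ^ 3 * (X 1 4 - X 4 1) + B.i * (X 2 3 - X 3 2)

/-- `∇_k h_{ij}`. -/
def nabla2 (h : Fin 5 → Fin 5 → A) (k i j : Fin 5) : A :=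
  B.frame k (h i j) - B.connSum k i (fun l => h l j) - B.connSum k j (fun l => h i l)

/-- `∇_k T_{pij}`. -/
def nabla3 (T : Fin 5 → Fin 5 → Fin 5 → A) (k p i j : Fin 5) : A :=
  B.frame k (T p i j) - B.connSum k p (fun l => T l i j)
    - B.connSum k i (fun l => T p l j) - B.connSum k j (fun l => T p i l)

/-- Twice the linearized Ricci tensor. -/
def twoRicci (h : Fin 5 → Fin 5 → A) (i j : Fin 5) : A :=
  B.trace fun α β => B.nabla3 (B.nabla2 h) α i j β + B.nabla3 (B.nabla2 h) α j i β
    - B.nabla3 (B.nabla2 h) α β i j - B.nabla3 (B.nabla2 h) i j α β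

/-- The symmetry operator. -/
def sym (h : Fin 5 → Fin 5 → A) (i j : Fin 5) : A :=
  B.yanoSum i (fun k l => B.nabla2 h k j l) + B.yanoSum j (fun k l => B.nabla2 h k i l)

end Background

/-- The components of `2 h_{A+} σ̄^A σ̄⁺ + 2 h_{A-} σ̄^A σ̄⁻`, with `(u, v, w)` the components
`h_{A+}` and `(u', v', w')` the components `h_{A-}`. -/
def modeTensor {A : Type*} [Zero A] (u v w u' v' w' : A) : Fin 5 → Fin 5 → A :=
  ![![0, 0, u, u', 0], ![0, 0, v, v', 0], ![u, v, 0, 0, w], ![u', v', 0, 0, w'],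
    ![0, 0, w, w', 0]]

/-! ### The symmetry operator on mode tensors. -/

namespace Background

variable {A : Type*} [CommRing A] [Algebra ℂ A] (B : Background A)

/-- The component `Z_{t+}` of the image of a mode tensor under the symmetry operator. -/
def symT (u v w : A) : A :=
  (2 - 2 * B.m * B.a ^ 2 * B.s ^ 4) * u + B.m * B.a ^ 2 * B.s ^ 3 * (B.dr u - B.dt v)
    + B.i * B.a * B.dt u + 2 * B.i * B.m * B.a ^ 3 * B.s ^ 5 * v
    - 2 * B.a * (B.m * B.s ^ 4 + B.s ^ 2) * w + B.a * (B.m * B.s ^ 3 - B.s) * B.dr w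

/-- The component `Z_{r+}` of the image of a mode tensor under the symmetry operator. -/
def symR (u v w : A) : A :=
  2 * B.i * (B.m * B.r * B.q - B.r ^ 3 * B.q + B.s) * (B.a * u + w) + 2 * v
    + B.i * B.a * B.dt v - B.a * B.r ^ 3 * B.q * B.dt w

/-- The component `Z_{3+}` of the image of a mode tensor under the symmetry operator. -/
def sym3 (u v w : A) : A :=
  2 * (B.m * B.a ^ 3 * B.s ^ 4 + B.a) * u
    + (B.m * B.a ^ 3 * B.s ^ 3 + B.a * B.r) * (B.dt v - B.dr u)
    - 2 * B.i * B.m * B.a ^ 2 * B.s ^ 3 * v + (2 * B.m * B.a ^ 2 * B.s ^ 4 + 6) * w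
    - B.m * B.a ^ 2 * B.s ^ 3 * B.dr w + B.i * B.a * B.dt w

lemma sym_comm (h : Fin 5 → Fin 5 → A) (i j : Fin 5) : B.sym h i j = B.sym h j i :=
  add_comm _ _

/-- The same background with the opposite imaginary unit. -/
def bar : Background A where
  __ := B
  i := -B.i
  κ := -B.κ
  hκ := by linear_combination -B.hκ
  ii := by linear_combination B.ii
  const := by simp

set_option maxHeartbeats 1000000 in
-- Charge conservation keeps the `+` and `-` components apart and creates no component of charge `0`
-- or `±2`. Exchanging `+` and `-` amounts to `i ↦ -i` in the connection and the Killing–Yano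
-- contraction, so the `-` components obey the `+` formulas over `bar`.
lemma sym_modeTensor (u v w u' v' w' : A) (i j : Fin 5) :
    B.sym (modeTensor u v w u' v' w') i j
      = modeTensor (B.symT u v w) (B.symR u v w) (B.sym3 u v w)
          (B.bar.symT u' v' w') (B.bar.symR u' v' w') (B.bar.sym3 u' v' w') i j := by
  have h1 := B.rs
  have h2 := B.pq
  have h3 := B.ii
  wlog hij : i ≤ j generalizing i j with H
  · rw [sym_comm, H j i (le_of_not_ge hij)]
    fin_cases i <;> fin_cases j <;> rfl
  fin_cases i <;> fin_cases j <;> first | (exact absurd hij (by decide)) | skip <;>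
    simp [sym, yanoSum, nabla2, connSum, modeTensor, frame, symT, symR, sym3, bar]
  all_goals grind

/-! ### Gauge-invariant variables and the momentum. -/

/-- The gauge-invariant variable `f_t`. -/
def fieldT (u w : A) : A := B.s ^ 2 * (u + B.κ * B.r ^ 4 * B.dt w + B.b * w)

/-- The gauge-invariant variable `f_r`. -/
def fieldR (v w : A) : A := B.s ^ 2 * (v + B.κ * B.r ^ 2 * B.dr (B.r ^ 2 * w))

/-- The momentum `π_r` as a function of `(f_t, f_r)`. -/
def mom (f g : A) : A :=
  B.r ^ 5 * (1 + B.m * B.a ^ 2 * B.s ^ 4) * (B.dt g - B.dr f) - 2 * B.i * B.m * B.a * B.r * g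

/-- The component `h_{t+}` in terms of `f_t` and `h_{3+}`. -/
def ofFieldT (f w : A) : A := B.r ^ 2 * f - B.κ * B.r ^ 4 * B.dt w - B.b * w

/-- The component `h_{r+}` in terms of `f_r` and `h_{3+}`. -/
def ofFieldR (g w : A) : A := B.r ^ 2 * g - B.κ * B.r ^ 4 * B.dr w - 2 * B.κ * B.r ^ 3 * w

lemma ofFieldT_fieldT (u w : A) : B.ofFieldT (B.fieldT u w) w = u := by
  have := B.rs
  simp only [ofFieldT, fieldT]
  grind

lemma ofFieldR_fieldR (v w : A) : B.ofFieldR (B.fieldR v w) w = v := by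
  have := B.rs
  simp [ofFieldR, fieldR, Derivation.leibniz, Derivation.leibniz_pow]
  grind

/-- The terms in `w` add up to `ofFieldT 0 (2w + i a ∂_t w)`. The same `2w + i a ∂_t w` governs
`symR_ofField` and is the `w` part of `sym3_ofField`: the part with `f = g = 0` is mapped to a part
of the same kind. -/
lemma symT_ofField (f g w : A) :
    B.symT (B.ofFieldT f w) (B.ofFieldR g w) w
      = 2 * B.r ^ 2 * f + B.i * B.a * B.r ^ 2 * B.dt f
        + B.m * B.a ^ 2 * B.s * (B.dr f - B.dt g) + 2 * B.i * B.m * B.a ^ 3 * B.s ^ 3 * g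
        - 2 * B.b * w - (B.i + 2 * B.κ * B.r ^ 4) * B.dt w
        - B.κ * B.i * B.a * B.r ^ 4 * B.dt (B.dt w) := by
  have h1 := B.rs
  have h2 := B.ii
  have h3 := B.ab
  have h4 := B.hκ
  simp [symT, ofFieldT, ofFieldR, Derivation.leibniz, Derivation.leibniz_pow,
    derivation_ofNat, B.comm]
  grind

lemma symR_ofField (f g w : A) :
    B.symR (B.ofFieldT f w) (B.ofFieldR g w) w
      = 2 * B.i * B.m * B.a ^ 3 * B.r * B.q * f + 2 * B.r ^ 2 * g
        + B.i * B.a * B.r ^ 2 * B.dt g - 4 * B.κ * B.r ^ 3 * w - 2 * B.κ * B.r ^ 4 * B.dr w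
        - 2 * B.κ * B.i * B.a * B.r ^ 3 * B.dt w
        - B.κ * B.i * B.a * B.r ^ 4 * B.dt (B.dr w) := by
  have h1 := B.rs
  have h2 := B.ii
  have h3 := B.ab
  have h4 := B.hκ
  have h5 := B.pq
  -- This is the defining relation of `q` multiplied by `s`; it removes a cancellation before the
  -- derivatives are expanded.
  have h6 : B.m * B.r * B.q - B.r ^ 3 * B.q + B.s = B.m * B.a ^ 2 * B.q * B.s := by grind
  simp [symR, ofFieldT, ofFieldR, Derivation.leibniz, Derivation.leibniz_pow,
    derivation_ofNat, h6]
  grind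

lemma sym3_ofField (f g w : A) :
    B.sym3 (B.ofFieldT f w) (B.ofFieldR g w) w
      = -B.a * (B.m * B.a ^ 2 * B.s + B.r ^ 3) * (B.dr f - B.dt g)
        - 2 * B.i * B.m * B.a ^ 2 * B.s * g + 2 * w + B.i * B.a * B.dt w := by
  have h1 := B.rs
  have h2 := B.ii
  have h3 := B.ab
  have h4 := B.hκ
  simp [sym3, ofFieldT, ofFieldR, Derivation.leibniz, Derivation.leibniz_pow,
    derivation_ofNat, B.comm]
  grind

/-- All terms in `w` cancel, as gauge invariance requires; likewise in `fieldR_sym`. -/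
lemma fieldT_sym (f g w : A) :
    B.fieldT (B.symT (B.ofFieldT f w) (B.ofFieldR g w) w)
        (B.sym3 (B.ofFieldT f w) (B.ofFieldR g w) w)
      = 2 * f - B.r * B.dr f + B.i * B.a * B.dt f
        - B.κ * B.a * (B.m * B.a ^ 2 * B.r + B.r ^ 5) * B.dt (B.dr f - B.dt g)
        + 2 * B.i * B.m * B.a * (B.a ^ 2 * B.s ^ 5 - B.s ^ 3) * g + 2 * B.r * B.dt g := by
  have h1 := B.rs
  have h2 := B.ii
  have h3 := B.ab
  have h4 := B.hκ
  rw [symT_ofField, sym3_ofField]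
  simp [fieldT, Derivation.leibniz, Derivation.leibniz_pow,
    derivation_ofNat, B.comm]
  grind

lemma fieldR_sym (f g w : A) :
    B.fieldR (B.symR (B.ofFieldT f w) (B.ofFieldR g w) w)
        (B.sym3 (B.ofFieldT f w) (B.ofFieldR g w) w)
      = 2 * B.i * B.a * (B.m * B.r * B.q - B.r ^ 3 * B.q + B.s) * f
        - B.κ * B.a * (B.m * B.a ^ 2 + 5 * B.r ^ 4) * B.dr f
        - B.κ * B.a * (B.m * B.a ^ 2 * B.r + B.r ^ 5) * B.dr (B.dr f - B.dt g)
        + 3 * g + B.r * B.dr g + B.κ * B.a * (3 * B.m * B.a ^ 2 + 5 * B.r ^ 4) * B.dt g := by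
  have h1 := B.rs
  have h2 := B.ii
  have h3 := B.ab
  have h4 := B.hκ
  have h5 := B.pq
  rw [symR_ofField, sym3_ofField]
  simp [fieldR, Derivation.leibniz, Derivation.leibniz_pow,
    derivation_ofNat, B.comm]
  grind 

/-- Holds without any field equation. The terms after `6 * B.mom f g` form the remainder to be
matched with the Einstein equation. -/
lemma mom_sym (f g w : A) :
    B.mom (B.fieldT (B.symT (B.ofFieldT f w) (B.ofFieldR g w) w)
        (B.sym3 (B.ofFieldT f w) (B.ofFieldR g w) w))
      (B.fieldR (B.symR (B.ofFieldT f w) (B.ofFieldR g w) w)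
        (B.sym3 (B.ofFieldT f w) (B.ofFieldR g w) w))
      = B.i * B.a * B.dt (B.mom f g) + 6 * B.mom f g
        + 4 * B.m ^ 2 * B.a ^ 4 * B.q * f + 4 * B.m * B.a ^ 2 * B.r * (B.dr f - B.dt g)
        + 2 * B.i * B.m * B.a ^ 3 * (B.m * B.r ^ 2 * B.q + 1) * B.dt f
        + B.i * B.m * B.a ^ 3 * (10 * B.m * B.a ^ 2 * B.s ^ 5 - 6 * B.m * B.s ^ 3 + 10 * B.s) * g
        - 2 * B.i * B.m * B.a ^ 3 * (B.m * B.a ^ 2 * B.s ^ 4 - B.m * B.s ^ 2 + 1) * B.dr g := by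
  have h1 := B.rs
  have h2 := B.ii
  have h4 := B.hκ
  have h5 := B.pq
  rw [fieldT_sym, fieldR_sym]
  simp [mom, Derivation.leibniz, Derivation.leibniz_pow, derivation_ofNat, B.comm]
  grind

/-! ### The `(+, 3)` component of the linearized Einstein equation. -/

set_option maxHeartbeats 4000000 in
-- The only component of the field equation that is needed. It has charge `1`, so `u'`, `v'`, `w'`
-- do not occur.
lemma twoRicci_two_four (u v w u' v' w' : A) :
    B.twoRicci (modeTensor u v w u' v' w') 2 4
      = 4 * B.m * B.a * (B.q + B.s ^ 4 - B.m * B.s ^ 2 * B.q) * u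
        - 4 * B.m * B.a * B.s ^ 3 * (B.dr u - B.dt v)
        - 2 * B.i * B.m * B.a ^ 2 * (B.s ^ 4 + B.m * B.s ^ 2 * B.q) * B.dt u
        - B.i * B.m * B.a ^ 2 *
          (14 * B.m * B.a ^ 2 * B.s ^ 9 - 10 * B.m * B.s ^ 7 + 14 * B.s ^ 5) * v
        + 2 * B.i * B.m * B.a ^ 2 * (B.m * B.a ^ 2 * B.s ^ 8 - B.m * B.s ^ 6 + B.s ^ 4) * B.dr v
        + (8 * B.m * B.a ^ 2 * B.s ^ 6 + 4 * B.m * B.q + 8 * B.s ^ 2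
          - 4 * B.m ^ 2 * B.s ^ 2 * B.q) * w
        + (B.m * B.a ^ 2 * B.s ^ 5 - 3 * B.m * B.s ^ 3 + B.s) * B.dr w
        - (B.m * B.a ^ 2 * B.s ^ 4 - B.m * B.s ^ 2 + 1) * B.dr (B.dr w)
        - 2 * B.i * B.m * B.a * (B.q + B.s ^ 4 + B.m * B.s ^ 2 * B.q) * B.dt w
        + (B.m * B.r ^ 2 * B.q + 1) * B.dt (B.dt w) := by
  have h1 := B.rs
  have h2 := B.ii
  have h5 := B.pq
  simp only [twoRicci, trace, nabla3, connSum]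
  -- The tensor stays opaque while the Leibniz rule is applied to the connection coefficients; its
  -- zero components are inserted afterwards.
  generalize hh : modeTensor u v w u' v' w' = h
  simp [nabla2, frame, connSum, Derivation.leibniz, Derivation.leibniz_pow,
    derivation_ofNat]
  subst hh
  simp [modeTensor]
  grind

/-- The linearized Ricci component is gauge invariant, so it depends on `f` and `g` only. The proof
collects coefficients: those of `w` and its derivatives vanish, those of `f`, `g` simplify. -/
lemma twoRicci_ofField (f g w u' v' w' : A) :
    B.twoRicci (modeTensor (B.ofFieldT f w) (B.ofFieldR g w) w u' v' w') 2 4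
      = -4 * B.m ^ 2 * B.a ^ 3 * B.q * B.s ^ 2 * f - 4 * B.m * B.a * B.s * (B.dr f - B.dt g)
        - 2 * B.i * B.m * B.a ^ 2 * (B.m * B.q + B.s ^ 2) * B.dt f
        - B.i * B.m * B.a ^ 2 *
          (10 * B.m * B.a ^ 2 * B.s ^ 7 - 6 * B.m * B.s ^ 5 + 10 * B.s ^ 3) * g
        + 2 * B.i * B.m * B.a ^ 2 * (B.m * B.a ^ 2 * B.s ^ 6 - B.m * B.s ^ 4 + B.s ^ 2)
          * B.dr g := by
  obtain ⟨r, s, q, a, b, m, κ, i, hr, hs, hq, ha, hb, hm, hκ', hi⟩ :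
      ∃ r s q a b m κ i, B.r = r ∧ B.s = s ∧ B.q = q ∧ B.a = a ∧ B.b = b ∧ B.m = m ∧ B.κ = κ ∧
        B.i = i := ⟨_, _, _, _, _, _, _, _, rfl, rfl, rfl, rfl, rfl, rfl, rfl, rfl⟩
  have h1 := B.rs
  have h2 := B.ii
  have h3 := B.ab
  have h4 := B.hκ
  have h5 := B.pq
  rw [twoRicci_two_four]
  simp [ofFieldT, ofFieldR, Derivation.leibniz, Derivation.leibniz_pow,
    derivation_ofNat, B.comm]
  rw [hr, hs] at h1
  rw [hi] at h2
  rw [ha, hb] at h3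
  rw [hm, ha, hκ', hi] at h4
  rw [hr, hm, ha, hq] at h5
  rw [hr, hs, hq, ha, hb, hm, hκ', hi]
  clear hr hs hq ha hb hm hκ' hi
  have e : i * (2 * m * a ^ 2 * κ) = -1 := by rw [h4]; linear_combination h2
  -- The defining relation of `q` multiplied by `s²`.
  have e' : m * a ^ 2 * s ^ 2 * q = s ^ 2 + m * q - r ^ 2 * q := by grind
  -- `c0` to `c4` are, up to sign, the coefficients of `w`, `∂_r w`, `∂_r² w`, `∂_t w`, `∂_t² w`;
  -- the mixed derivatives cancel because `∂_t` and `∂_r` commute.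
  have c0 : -4 * m * a * b * (q + s ^ 4 - m * s ^ 2 * q)
      + i * (2 * m * a ^ 2 * κ) * (14 * m * a ^ 2 * s ^ 9 - 10 * m * s ^ 7 + 14 * s ^ 5) * r ^ 3
      - i * (2 * m * a ^ 2 * κ) * (m * a ^ 2 * s ^ 8 - m * s ^ 6 + s ^ 4) * 6 * r ^ 2
      + (8 * m * a ^ 2 * s ^ 6 + 4 * m * q + 8 * s ^ 2 - 4 * m ^ 2 * s ^ 2 * q) = 0 := by
    rw [e]; grind
  have c1 : 4 * m * a * b * s ^ 3
      + i * (2 * m * a ^ 2 * κ) * (7 * m * a ^ 2 * s ^ 9 - 5 * m * s ^ 7 + 7 * s ^ 5) * r ^ 4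
      - i * (2 * m * a ^ 2 * κ) * (m * a ^ 2 * s ^ 8 - m * s ^ 6 + s ^ 4) * 6 * r ^ 3
      + (m * a ^ 2 * s ^ 5 - 3 * m * s ^ 3 + s) = 0 := by
    rw [e]; grind
  have c2 : i * (2 * m * a ^ 2 * κ) * (m * a ^ 2 * s ^ 8 - m * s ^ 6 + s ^ 4) * r ^ 4
      + (m * a ^ 2 * s ^ 4 - m * s ^ 2 + 1) = 0 := by
    rw [e]; grind
  have h6 : 2 * m * a * κ = i * b := by
    linear_combination b * h4 - 2 * m * a * κ * h3
  have c3 : -2 * (2 * m * a * κ) * (q + s ^ 4 - m * s ^ 2 * q) * r ^ 4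
      + 4 * (2 * m * a * κ) * s ^ 3 * r ^ 3 + 2 * i * m * a ^ 2 * b * (s ^ 4 + m * s ^ 2 * q)
      - 2 * i * m * a * (q + s ^ 4 + m * s ^ 2 * q) = 0 := by
    rw [h6]; grind
  have c4 : i * (2 * m * a ^ 2 * κ) * (s ^ 4 + m * s ^ 2 * q) * r ^ 4 + m * r ^ 2 * q + 1 = 0 := by
    rw [e]; grind
  -- `d0` to `d4` simplify the coefficients of `f`, `∂_t f`, `∂_r f - ∂_t g`, `g`, `∂_r g`, up to
  -- common factors.
  have d0 : 4 * m * a * (q + s ^ 4 - m * s ^ 2 * q) * r ^ 2 - 8 * m * a * s ^ 3 * r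
      = -4 * m ^ 2 * a ^ 3 * q * s ^ 2 := by grind
  have d1 : (s ^ 4 + m * s ^ 2 * q) * r ^ 2 = m * q + s ^ 2 := by grind
  have d2 : s ^ 3 * r ^ 2 = s := by grind
  have d3 : (14 * m * a ^ 2 * s ^ 9 - 10 * m * s ^ 7 + 14 * s ^ 5) * r ^ 2
      - 4 * (m * a ^ 2 * s ^ 8 - m * s ^ 6 + s ^ 4) * r
      = 10 * m * a ^ 2 * s ^ 7 - 6 * m * s ^ 5 + 10 * s ^ 3 := by grind
  have d4 : (m * a ^ 2 * s ^ 8 - m * s ^ 6 + s ^ 4) * r ^ 2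
      = m * a ^ 2 * s ^ 6 - m * s ^ 4 + s ^ 2 := by grind
  linear_combination w * c0 + B.dr w * c1 - B.dr (B.dr w) * c2 + B.dt w * c3
    + B.dt (B.dt w) * c4 + f * d0 - 2 * i * m * a ^ 2 * B.dt f * d1
    - 4 * m * a * (B.dr f - B.dt g) * d2 - i * m * a ^ 2 * g * d3
    + 2 * i * m * a ^ 2 * B.dr g * d4

/-- The effect of the symmetry operator on the momentum, up to the linearized Einstein equation. -/
lemma mom_symmetry (u v w u' v' w' : A) :
    B.mom (B.fieldT (B.symT u v w) (B.sym3 u v w)) (B.fieldR (B.symR u v w) (B.sym3 u v w))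
      = B.i * B.a * B.dt (B.mom (B.fieldT u w) (B.fieldR v w))
        + 6 * B.mom (B.fieldT u w) (B.fieldR v w)
        - B.a * B.r ^ 2 * B.twoRicci (modeTensor u v w u' v' w') 2 4 := by
  obtain ⟨f, hf⟩ : ∃ f, B.fieldT u w = f := ⟨_, rfl⟩
  obtain ⟨g, hg⟩ : ∃ g, B.fieldR v w = g := ⟨_, rfl⟩
  have hu : u = B.ofFieldT f w := by rw [← hf, ofFieldT_fieldT]
  have hv : v = B.ofFieldR g w := by rw [← hg, ofFieldR_fieldR]
  -- In these variables the remainder of `mom_sym` and `-a r²` times the Ricci component differ only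
  -- by uses of `r s = 1`.
  rw [hf, hg, hu, hv, mom_sym, twoRicci_ofField]
  have h1 := B.rs
  grind

/-! ### Justification of the closed formulas for connection and contractions. -/

/-- Frame components of the metric. -/
def g : Fin 5 → Fin 5 → A :=
  ![![B.m * B.s ^ 2 - 1, 0, 0, 0, -(B.m * B.a * B.s ^ 2)],
    ![0, B.r ^ 4 * B.q, 0, 0, 0],
    ![0, 0, 0, B.r ^ 2, 0],
    ![0, 0, B.r ^ 2, 0, 0],
    ![-(B.m * B.a * B.s ^ 2), 0, 0, 0, B.r ^ 2 + B.m * B.a ^ 2 * B.s ^ 2]]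

/-- Frame components of the inverse metric. -/
def gInv : Fin 5 → Fin 5 → A :=
  ![![-(B.m * B.a ^ 2 * B.q) - B.r ^ 4 * B.q, 0, 0, 0, -(B.m * B.a * B.q)],
    ![0, B.m * B.a ^ 2 * B.s ^ 4 - B.m * B.s ^ 2 + 1, 0, 0, 0],
    ![0, 0, 0, B.s ^ 2, 0],
    ![0, 0, B.s ^ 2, 0, 0],
    ![-(B.m * B.a * B.q), 0, 0, 0, B.r ^ 2 * B.q - B.m * B.q]]

/-- Structure coefficients of the frame. -/
def str : Fin 5 → Fin 5 → Fin 5 → A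
  | 4, 2, 3 => 2 * B.i
  | 4, 3, 2 => -2 * B.i
  | 2, 4, 2 => 2 * B.i
  | 2, 2, 4 => -2 * B.i
  | 3, 4, 3 => -2 * B.i
  | 3, 3, 4 => 2 * B.i
  | _, _, _ => 0

lemma g_mul_gInv (i j : Fin 5) : ∑ k, B.g i k * B.gInv k j = if i = j then 1 else 0 := by
  have h1 := B.rs
  have h2 := B.pq
  rw [Fin.sum_univ_five]
  fin_cases i <;> fin_cases j <;> simp [g, gInv] <;> grind

lemma sum_gInv (X : Fin 5 → Fin 5 → A) : ∑ k, ∑ l, B.gInv k l * X k l = B.trace X := by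
  simp [Fin.sum_univ_five, gInv, trace]
  ring

/-- `connSum k i` is linear in `X`, so its values on the standard basis are the coefficients
`Γ^l_{ki}`. -/
lemma sum_connSum_single (k i : Fin 5) (X : Fin 5 → A) :
    ∑ l, B.connSum k i (Pi.single l 1) * X l = B.connSum k i X := by
  rw [Fin.sum_univ_five]
  fin_cases k <;> fin_cases i <;> simp [connSum] <;> ring

/-- The sum `∑ s, g^{ks} Y s`. -/
def raise (k : Fin 5) (Y : Fin 5 → A) : A :=
  match k with
  | 0 => (-(B.m * B.a ^ 2 * B.q) - B.r ^ 4 * B.q) * Y 0 - B.m * B.a * B.q * Y 4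
  | 1 => (B.m * B.a ^ 2 * B.s ^ 4 - B.m * B.s ^ 2 + 1) * Y 1
  | 2 => B.s ^ 2 * Y 3
  | 3 => B.s ^ 2 * Y 2
  | 4 => (B.r ^ 2 * B.q - B.m * B.q) * Y 4 - B.m * B.a * B.q * Y 0

lemma sum_gInv_row (k : Fin 5) (Y : Fin 5 → A) : ∑ s, B.gInv k s * Y s = B.raise k Y := by
  rw [Fin.sum_univ_five]
  fin_cases k <;> simp [gInv, raise] <;> ring

set_option maxHeartbeats 4000000 in
-- Certifies the table `connSum` against the Koszul formula, entry by entry.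
lemma koszul (k i j : Fin 5) :
    2 * B.connSum i j (Pi.single k 1)
      = ∑ s, B.gInv k s * (B.frame i (B.g j s) + B.frame j (B.g i s) - B.frame s (B.g i j)
        + ∑ l, (B.str l i j * B.g l s - B.str l i s * B.g l j - B.str l j s * B.g l i)) := by
  have h1 := B.rs
  have h2 := B.pq
  -- The inverse metric has at most two nonzero entries per row; using this first keeps the cases
  -- small.
  rw [sum_gInv_row]
  simp only [Fin.sum_univ_five]
  fin_cases k <;> simp only [raise] <;> fin_cases i <;> fin_cases j <;>
    simp [connSum, g, str, frame, Derivation.leibniz,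
      Derivation.leibniz_pow] <;> grind

/-- The Killing-Yano 3-form. -/
def yano (i j k : Fin 5) : A :=
  -B.a * B.r * algebraMap ℂ A (wedge3 0 1 4 i j k)
    - B.i * B.r ^ 2 * (-B.a * algebraMap ℂ A (wedge3 2 3 0 i j k)
      + B.r ^ 2 * algebraMap ℂ A (wedge3 2 3 4 i j k))

set_option maxHeartbeats 4000000 in
-- Certifies the table `yanoSum`: its coefficients are those of the Killing–Yano form with two
-- indices raised.
lemma raise_raise_yano (i k l : Fin 5) :
    B.raise k (fun α => B.raise l (fun β => B.yano i α β))
      = B.yanoSum i (Pi.single k (Pi.single l 1)) := by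
  have h1 := B.rs
  have h2 := B.pq
  fin_cases i <;> fin_cases k <;> fin_cases l <;>
    simp [raise, yano, yanoSum, wedge3, Matrix.det_fin_three] <;> grind

lemma sum_yanoSum_single (i : Fin 5) (X : Fin 5 → Fin 5 → A) :
    ∑ k, ∑ l, B.yanoSum i (Pi.single k (Pi.single l 1)) * X k l = B.yanoSum i X := by
  simp only [Fin.sum_univ_five]
  fin_cases i <;> simp [yanoSum] <;> ring

end Background

end MyersPerry

/-! ### From the algebra back to tensors on the chart. -/

namespace MyersPerry

open scoped ContDiff Topology
open TopologicalSpace (Opens)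
open smoothFn

variable {U : Opens (ℝ × ℝ)}

lemma der_algebraMap (e : ℝ × ℝ) (c : ℂ) : der e (algebraMap ℂ (smoothFn U) c) = 0 :=
  (der e).map_algebraMap c

/-- The Myers-Perry background over `U`. -/
def background {a μ : ℝ} (ha : a ≠ 0) (hμ : 0 < μ)
    (hU : ∀ p ∈ U, 0 < p.2 ∧ G a μ p.2 ≠ 0) : Background (smoothFn U) where
  r := r
  s := inv r fun p => by
    rw [r_apply]; exact_mod_cast (hU _ p.2).1.ne'
  q := inv (r ^ 4 - algebraMap ℂ _ (μ : ℂ) * r ^ 2 + algebraMap ℂ _ (μ : ℂ) * algebraMap ℂ _ (a : ℂ) ^ 2)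
    fun p => by
      have h0 : p.1.2 ≠ 0 := (hU _ p.2).1.ne'
      -- This polynomial is `r⁴ G(r)`.
      have h : p.1.2 ^ 4 - μ * p.1.2 ^ 2 + μ * a ^ 2 ≠ 0 := by
        have h1 := (hU _ p.2).2
        contrapose! h1
        rw [G]
        field_simp
        linear_combination h1
      have h' : ((p.1.2 ^ 4 - μ * p.1.2 ^ 2 + μ * a ^ 2 : ℝ) : ℂ) ≠ 0 := by exact_mod_cast h
      push_cast at h'
      exact h'
  a := algebraMap ℂ _ (a : ℂ)
  b := algebraMap ℂ _ (1 / (a : ℂ))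
  m := algebraMap ℂ _ (μ : ℂ)
  κ := algebraMap ℂ _ (Complex.I / (2 * μ * a ^ 2))
  i := algebraMap ℂ _ Complex.I
  dt := der (1, 0)
  dr := der (0, 1)
  dt_r := by simp [der_r]
  dr_r := by simp [der_r]
  rs := mul_inv _ _
  pq := mul_inv _ _
  ab := by
    rw [← map_mul, mul_one_div_cancel (by exact_mod_cast ha), map_one]
  hκ := by
    have h1 : (a : ℂ) ≠ 0 := by exact_mod_cast ha
    have h2 : (μ : ℂ) ≠ 0 := by exact_mod_cast hμ.ne'
    rw [← map_ofNat (algebraMap ℂ (smoothFn U)) 2, ← map_pow, ← map_mul, ← map_mul, ← map_mul]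
    congr 1
    field_simp
  ii := by rw [← map_pow, Complex.I_sq, map_neg, map_one]
  const := by
    simp only [List.mem_cons, List.not_mem_nil, or_false]
    rintro c (rfl | rfl | rfl | rfl | rfl) <;> exact ⟨der_algebraMap _ _, der_algebraMap _ _⟩
  comm := der_comm _ _

variable {a μ : ℝ} (ha : a ≠ 0) (hμ : 0 < μ) (hU : ∀ p ∈ U, 0 < p.2 ∧ G a μ p.2 ≠ 0)

lemma Rep.frame {F : Coord → ℂ} {f : smoothFn U} (h : Rep F f) (k : Fin 5) :
    Rep (MyersPerry.frameD k F) ((background ha hμ hU).frame k f) :=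
  (h.frameD k).of_eq (by fin_cases k <;> rfl)

lemma background_s_apply (p : U) : (background ha hμ hU).s.1 p = (p.1.2 : ℂ)⁻¹ :=
  eq_inv_of_mul_eq_one_right (congrArg (fun f : smoothFn U => f.1 p) (background ha hμ hU).rs)

lemma background_q_apply (p : U) : (background ha hμ hU).q.1 p
    = ((p.1.2 : ℂ) ^ 4 - μ * (p.1.2 : ℂ) ^ 2 + μ * (a : ℂ) ^ 2)⁻¹ :=
  eq_inv_of_mul_eq_one_right (congrArg (fun f : smoothFn U => f.1 p) (background ha hμ hU).pq)

lemma background_r_apply (p : U) : (background ha hμ hU).r.1 p = (p.1.2 : ℂ) := rfl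

lemma background_a_apply (p : U) : (background ha hμ hU).a.1 p = (a : ℂ) := rfl

lemma background_b_apply (p : U) : (background ha hμ hU).b.1 p = 1 / (a : ℂ) := rfl

lemma background_m_apply (p : U) : (background ha hμ hU).m.1 p = (μ : ℂ) := rfl

lemma background_i_apply (p : U) : (background ha hμ hU).i.1 p = Complex.I := rfl

lemma background_κ_apply (p : U) :
    (background ha hμ hU).κ.1 p = Complex.I / (2 * μ * (a : ℂ) ^ 2) := rfl

lemma rep_metric (i j : Fin 5) :
    Rep (fun x => metric a μ x i j) ((background ha hμ hU).g i j) := fun x hx => by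
  have h0 : x 1 ≠ 0 := (hU _ hx.1).1.ne'
  have h1 := (hU _ hx.1).2
  have h0' : (x 1 : ℂ) ≠ 0 := by exact_mod_cast h0
  have h2 : 1 / G a μ (x 1) = x 1 ^ 4 * (x 1 ^ 4 - μ * x 1 ^ 2 + μ * a ^ 2)⁻¹ := by
    have h3 : x 1 ^ 4 - μ * x 1 ^ 2 + μ * a ^ 2 = x 1 ^ 4 * G a μ (x 1) := by
      rw [G]; field_simp
    rw [h3]
    simp only at h1
    field_simp
  fin_cases i <;> fin_cases j <;>
    simp [metric, h2, Background.g, background_s_apply, background_q_apply, background_r_apply,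
      background_a_apply, background_m_apply] <;> field_simp <;> ring

/-- A one-sided inverse of a square matrix is its inverse, so `g_mul_gInv` suffices. -/
lemma rep_invMetric (i j : Fin 5) :
    Rep (fun x => invMetric a μ x i j) ((background ha hμ hU).gInv i j) := fun x hx => by
  have h : metric a μ x * Matrix.of (fun i j =>
      ((background ha hμ hU).gInv i j).1 ⟨(x 0, x 1), hx.1⟩) = 1 := by
    ext i j
    have := congrArg (fun f : smoothFn U => f.1 ⟨(x 0, x 1), hx.1⟩)
      ((background ha hμ hU).g_mul_gInv i j)
    have e : ∀ k, metric a μ x i k = ((background ha hμ hU).g i k).1 ⟨(x 0, x 1), hx.1⟩ :=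
      fun k => rep_metric ha hμ hU i k x hx
    rw [Matrix.mul_apply, Matrix.one_apply]
    simp only [e, Matrix.of_apply]
    by_cases hij : i = j
    · subst hij; simpa using this
    · simpa [hij] using this
  simp only [invMetric]
  rw [Matrix.inv_eq_right_inv h]
  rfl

lemma background_str (i j k : Fin 5) :
    (background ha hμ hU).str i j k = algebraMap ℂ (smoothFn U) (structC i j k) := by
  have h : (background ha hμ hU).i = algebraMap ℂ (smoothFn U) Complex.I := rfl
  have h2 : algebraMap ℂ (smoothFn U) 2 = 2 := map_ofNat _ 2
  fin_cases i <;> fin_cases j <;> fin_cases k <;> simp [structC, Background.str, h, h2] <;> ring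

lemma smoothFn.half_mul {x y : smoothFn U} (h : 2 * x = y) :
    algebraMap ℂ (smoothFn U) (1 / 2) * y = x := by
  rw [← h, ← map_ofNat (algebraMap ℂ (smoothFn U)) 2, ← mul_assoc, ← map_mul]
  norm_num

lemma rep_conn (k i j : Fin 5) :
    Rep (conn a μ k i j) ((background ha hμ hU).connSum i j (Pi.single k 1)) := by
  have R : Rep (conn a μ k i j) _ :=
    (Rep.const (U := U) (1 / 2)).mul (Rep.sum Finset.univ fun s _ =>
      (rep_invMetric ha hμ hU k s).mul
        (((((rep_metric ha hμ hU j s).frame ha hμ hU i).add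
          ((rep_metric ha hμ hU i s).frame ha hμ hU j)).sub ((rep_metric ha hμ hU i j).frame ha hμ hU s)).add
          (Rep.sum Finset.univ fun l _ =>
            (((Rep.const (structC l i j)).mul (rep_metric ha hμ hU l s)).sub
              ((Rep.const (structC l i s)).mul (rep_metric ha hμ hU l j))).sub
              ((Rep.const (structC l j s)).mul (rep_metric ha hμ hU l i)))))
  refine R.of_eq (half_mul ?_)
  rw [Background.koszul]
  simp only [background_str]

lemma rep_connSum {F : Fin 5 → Coord → ℂ} {f : Fin 5 → smoothFn U} (h : ∀ l, Rep (F l) (f l))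
    (k i : Fin 5) : Rep (fun x => ∑ l, conn a μ l k i x * F l x)
      ((background ha hμ hU).connSum k i f) :=
  (Rep.sum Finset.univ fun l _ => (rep_conn ha hμ hU l k i).mul (h l)).of_eq
    ((background ha hμ hU).sum_connSum_single k i f)

lemma rep_cov2 {h : Tensor2} {H : Fin 5 → Fin 5 → smoothFn U} (hh : ∀ i j, Rep (h i j) (H i j))
    (k i j : Fin 5) : Rep (cov2 a μ h k i j) ((background ha hμ hU).nabla2 H k i j) :=
  (((hh i j).frame ha hμ hU k).sub (rep_connSum ha hμ hU (fun l => hh l j) k i)).sub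
    (rep_connSum ha hμ hU (fun l => hh i l) k j)

lemma rep_cov3 {T : Tensor3} {S : Fin 5 → Fin 5 → Fin 5 → smoothFn U}
    (hT : ∀ p i j, Rep (T p i j) (S p i j)) (k p i j : Fin 5) :
    Rep (cov3 a μ T k p i j) ((background ha hμ hU).nabla3 S k p i j) :=
  ((((hT p i j).frame ha hμ hU k).sub (rep_connSum ha hμ hU (fun l => hT l i j) k p)).sub
    (rep_connSum ha hμ hU (fun l => hT p l j) k i)).sub (rep_connSum ha hμ hU (fun l => hT p i l) k j)

lemma rep_linRicci {h : Tensor2} {H : Fin 5 → Fin 5 → smoothFn U}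
    (hh : ∀ i j, Rep (h i j) (H i j)) (i j : Fin 5) :
    Rep (linRicci a μ h i j)
      (algebraMap ℂ _ (1 / 2) * (background ha hμ hU).twoRicci H i j) := by
  have c := rep_cov3 ha hμ hU
    (rep_cov2 ha hμ hU hh)
  have R : Rep (linRicci a μ h i j) _ :=
    (Rep.const (U := U) (1 / 2)).mul (Rep.sum Finset.univ fun α _ => Rep.sum Finset.univ fun β _ =>
      (rep_invMetric ha hμ hU α β).mul
        ((((c α i j β).add (c α j i β)).sub (c α β i j)).sub (c i j α β)))
  exact R.of_eq (by rw [(background ha hμ hU).sum_gInv]; rfl)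

lemma rep_killingYano (i j k : Fin 5) :
    Rep (killingYano a i j k) ((background ha hμ hU).yano i j k) := fun x hx => by
  simp [killingYano, Background.yano, background_a_apply, background_r_apply, background_i_apply]

lemma rep_killingYanoUp (i k l : Fin 5) :
    Rep (killingYanoUp a μ i k l)
      ((background ha hμ hU).yanoSum i (Pi.single k (Pi.single l 1))) := by
  have R : Rep (killingYanoUp a μ i k l) _ :=
    Rep.sum Finset.univ fun α _ => Rep.sum Finset.univ fun β _ =>
      ((rep_invMetric ha hμ hU k α).mul
        (rep_invMetric ha hμ hU l β)).mul (rep_killingYano ha hμ hU i α β)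
  refine R.of_eq ?_
  rw [← Background.raise_raise_yano]
  simp only [← Background.sum_gInv_row, Finset.mul_sum, mul_assoc]

lemma rep_symOp {h : Tensor2} {H : Fin 5 → Fin 5 → smoothFn U}
    (hh : ∀ i j, Rep (h i j) (H i j)) (i j : Fin 5) :
    Rep (symOp a μ h i j) ((background ha hμ hU).sym H i j) := by
  have c := rep_cov2 ha hμ hU hh
  have R : Rep (symOp a μ h i j) _ :=
    Rep.sum Finset.univ fun k _ => Rep.sum Finset.univ fun l _ =>
      ((rep_killingYanoUp ha hμ hU i k l).mul (c k j l)).add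
        ((rep_killingYanoUp ha hμ hU j k l).mul (c k i l))
  refine R.of_eq ?_
  simp only [Finset.sum_add_distrib]
  rw [Background.sum_yanoSum_single, Background.sum_yanoSum_single, Background.sym]

lemma smoothFn.ofNat_apply (n : ℕ) [n.AtLeastTwo] (p : U) :
    (ofNat(n) : smoothFn U).1 p = ofNat(n) := rfl

lemma frameA_zero (f : smoothFn U) : frameA 0 f = (background ha hμ hU).dt f := rfl

lemma frameA_one (f : smoothFn U) : frameA 1 f = (background ha hμ hU).dr f := rfl

lemma rep_gaugeT {h : Tensor2} {u w : smoothFn U} (hu : Rep (h 0 2) u) (hw : Rep (h 2 4) w) :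
    Rep (gaugeT a μ h) ((background ha hμ hU).fieldT u w) := fun x hx => by
  simp only [gaugeT, hw.pd 0 x hx, hu x hx, hw x hx]
  simp [-mul_eq_mul_left_iff, Background.fieldT, background_s_apply, background_r_apply, background_κ_apply,
    background_b_apply, frameA_zero ha hμ hU]
  ring

lemma rep_gaugeR {h : Tensor2} {v w : smoothFn U} (hv : Rep (h 1 2) v) (hw : Rep (h 2 4) w) :
    Rep (gaugeR a μ h) ((background ha hμ hU).fieldR v w) := fun x hx => by
  have R : Rep (fun y => (y 1 : ℂ) ^ 2 * h 2 4 y) ((background ha hμ hU).r ^ 2 * w) :=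
    (((Rep.radius.mul Rep.radius).mul hw).congr fun y _ => by rw [sq]).of_eq (by rw [sq]; rfl)
  simp only [gaugeR, R.pd 1 x hx, hv x hx]
  simp [-mul_eq_mul_left_iff, Background.fieldR, background_s_apply, background_r_apply, background_κ_apply,
    frameA_one ha hμ hU]
  ring

lemma rep_momentum {h : Tensor2} {u v w : smoothFn U} (hu : Rep (h 0 2) u) (hv : Rep (h 1 2) v)
    (hw : Rep (h 2 4) w) : Rep (momentum a μ h)
      ((background ha hμ hU).mom ((background ha hμ hU).fieldT u w)
        ((background ha hμ hU).fieldR v w)) := fun x hx => by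
  have R := rep_gaugeR ha hμ hU hv hw
  have T := rep_gaugeT ha hμ hU hu hw
  simp only [momentum, R.pd 0 x hx, T.pd 1 x hx, R x hx]
  generalize (background ha hμ hU).fieldT u w = f
  generalize (background ha hμ hU).fieldR v w = g
  simp [-mul_eq_mul_left_iff, -mul_eq_mul_right_iff, Background.mom, ofNat_apply, background_s_apply, background_r_apply, background_a_apply,
    background_m_apply, background_i_apply, frameA_zero ha hμ hU, frameA_one ha hμ hU]
  ring

/-! ### The master factor and the master variable. -/

/-- Real powers are smooth away from base `0`; here all bases are positive because `μ, r > 0`. -/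
lemma contDiffAt_masterFactor (a : ℝ) {μ r : ℝ} (hμ : 0 < μ) (hr : 0 < r) :
    ContDiffAt ℝ ∞ (masterFactor a μ) r := by
  have h1 : 1 + μ * a ^ 2 / r ^ 4 ≠ 0 := by positivity
  have h2 : 1 + μ * a ^ 2 / r ^ 4 + μ ^ 2 * a ^ 6 / (4 * r ^ 10) ≠ 0 := by positivity
  have h3 : r ^ (5 / 2 : ℝ) * (1 + μ * a ^ 2 / r ^ 4 + μ ^ 2 * a ^ 6 / (4 * r ^ 10)) ^ (1 / 2 : ℝ)
      ≠ 0 := by positivity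
  have d1 : ContDiffAt ℝ ∞ (fun r : ℝ => 1 + μ * a ^ 2 / r ^ 4) r :=
    contDiffAt_const.add (contDiffAt_const.div (contDiffAt_id.pow 4) (by simp; positivity))
  have d2 : ContDiffAt ℝ ∞ (fun r : ℝ => μ ^ 2 * a ^ 6 / (4 * r ^ 10)) r :=
    contDiffAt_const.div (contDiffAt_const.mul (contDiffAt_id.pow 10)) (by simp; positivity)
  exact (d1.rpow_const_of_ne h1).div
    ((contDiffAt_id.rpow_const_of_ne hr.ne').mul ((d1.add d2).rpow_const_of_ne h2)) h3

/-- The master factor as a function of `(t, r)`. -/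
def masterFn (a : ℝ) {μ : ℝ} (hμ : 0 < μ) (hU : ∀ p ∈ U, 0 < p.2) : smoothFn U :=
  of (fun p => (masterFactor a μ p.2 : ℂ)) fun p hp =>
    (Complex.ofRealCLM.contDiff.contDiffAt.comp p
      ((contDiffAt_masterFactor a hμ (hU p hp)).comp p contDiffAt_snd)).contDiffWithinAt

lemma der_masterFn (a : ℝ) {μ : ℝ} (hμ : 0 < μ) (hU : ∀ p ∈ U, 0 < p.2) :
    der (1, 0) (masterFn (U := U) a hμ hU) = 0 := by
  ext p
  rw [der_apply_of_eq _ (F := fun p => (masterFactor a μ p.2 : ℂ)) (fun q => rfl) p]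
  have h1 := (contDiffAt_masterFactor a hμ (hU _ p.2)).differentiableAt (by simp)
  have h2 := (Complex.ofRealCLM.hasFDerivAt.comp p.1.2 h1.hasFDerivAt).comp p.1
    (hasFDerivAt_snd (p := p.1))
  have h3 : fderiv ℝ (fun p : ℝ × ℝ => (masterFactor a μ p.2 : ℂ)) p.1 = _ := h2.fderiv
  rw [h3]
  simp

lemma rep_master {h : Tensor2} {u v w : smoothFn U} (hu : Rep (h 0 2) u) (hv : Rep (h 1 2) v)
    (hw : Rep (h 2 4) w) : Rep (master a μ h) (masterFn a hμ (fun p hp => (hU p hp).1) *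
      (background ha hμ hU).mom ((background ha hμ hU).fieldT u w)
        ((background ha hμ hU).fieldR v w)) := fun x hx => by
  rw [master, rep_momentum ha hμ hU hu hv hw x hx]
  rfl

/-! ### Real modes and the action on the master variable. -/

/-- A mode tensor with conjugate `+` and `-` components. -/
def realMode (u v w : smoothFn U) : Fin 5 → Fin 5 → smoothFn U :=
  modeTensor u v w (conj u) (conj v) (conj w)

lemma realMode_apply (u v w : smoothFn U) (p : U) (i j : Fin 5) :
    (realMode u v w i j).1 p = modeMatrix (u.1 p) (v.1 p) (w.1 p) i j := by
  fin_cases i <;> fin_cases j <;> simp [realMode, modeTensor, modeMatrix, conj_apply]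

/-- Conjugation commutes with `∂_t`, `∂_r`, fixes the real coefficients and sends `i` to `-i`, so it
turns the formulas over the background into those over `bar`. -/
lemma sym_realMode (u v w : smoothFn U) (i j : Fin 5) :
    (background ha hμ hU).sym (realMode u v w) i j
      = realMode ((background ha hμ hU).symT u v w) ((background ha hμ hU).symR u v w)
          ((background ha hμ hU).sym3 u v w) i j := by
  have ht : ∀ f, (background ha hμ hU).dt (conj f) = conj ((background ha hμ hU).dt f) :=
    der_conj _
  have hr : ∀ f, (background ha hμ hU).dr (conj f) = conj ((background ha hμ hU).dr f) :=
    der_conj _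
  rw [realMode, Background.sym_modeTensor, realMode]
  congr 1 <;> ext p <;>
    simp [ofNat_apply, Background.bar, Background.symT, Background.symR, Background.sym3, conj_apply, ht, hr,
      background_s_apply, background_q_apply, background_r_apply, background_a_apply,
      background_m_apply, background_i_apply]

lemma isMode010_iff {h : Tensor2} :
    IsMode010 U h ↔ ∃ u v w : smoothFn U, ∀ i j, Rep (h i j) (realMode u v w i j) := by
  constructor
  · rintro ⟨u, v, w, hu, hv, hw, H⟩
    exact ⟨of u hu, of v hv, of w hw, fun i j x hx => by rw [H x hx, realMode_apply]; rfl⟩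
  · rintro ⟨u, v, w, H⟩
    refine ⟨extZero u.1, extZero v.1, extZero w.1, u.2, v.2, w.2, fun x hx i j => ?_⟩
    rw [H i j x hx, realMode_apply, extZero_apply _ hx.1, extZero_apply _ hx.1,
      extZero_apply _ hx.1]

/-- No regularity of `φ` is assumed, so the product is differentiated only along the line in
direction `t`, where `φ` is constant; `Rep` supplies the differentiability of `F`. -/
lemma Rep.pd_zero_of_eq_exp {F : Coord → ℂ} {f : smoothFn U} (hF : Rep F f) {ν : ℂ} {φ : ℝ → ℂ}
    (h : ∀ x ∈ chart U, F x = Complex.exp (-Complex.I * ν * x 0) * φ (x 1)) {x : Coord}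
    (hx : x ∈ chart U) : MyersPerry.pd 0 F x = -Complex.I * ν * F x := by
  have hd := hF.hasFDerivAt hx
  have hl : HasDerivAt (fun s : ℝ => x + s • (Pi.single 0 1 : Coord)) (Pi.single 0 1) 0 := by
    simpa using ((hasDerivAt_id (0 : ℝ)).smul_const (Pi.single 0 1 : Coord)).const_add x
  have h0 : x + (0 : ℝ) • (Pi.single 0 1 : Coord) = x := by simp
  have h1 : HasDerivAt (fun s : ℝ => F (x + s • (Pi.single 0 1 : Coord)))
      (MyersPerry.pd 0 F x) 0 := by
    rw [MyersPerry.pd, hd.fderiv]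
    exact HasFDerivAt.comp_hasDerivAt 0 (by rwa [h0]) hl
  have h2 : HasDerivAt (fun s : ℝ => Complex.exp (-Complex.I * ν * ((x 0 + s : ℝ) : ℂ)) * φ (x 1))
      (-Complex.I * ν * F x) 0 := by
    have e : HasDerivAt (fun s : ℝ => ((x 0 + s : ℝ) : ℂ)) 1 0 := by
      simpa using ((hasDerivAt_id (0 : ℝ)).const_add (x 0)).ofReal_comp
    refine (((e.const_mul (-Complex.I * ν)).cexp).mul_const (φ (x 1))).congr_deriv ?_
    rw [h x hx]
    simp
    ring
  refine h1.unique (h2.congr_of_eventuallyEq ?_)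
  have hc : Filter.Tendsto (fun s : ℝ => x + s • (Pi.single 0 1 : Coord)) (𝓝 0) (𝓝 x) := by
    simpa [h0] using hl.continuousAt.tendsto
  filter_upwards [hc.eventually ((isOpen_chart U).mem_nhds hx)] with s hs
  rw [h _ hs]
  simp

/-- The symmetry operator preserves the real modes and acts on the master variable of a solution
of the linearized vacuum equation as `i a ∂_t + 6`. -/
lemma master_symOp {a μ : ℝ} (ha : a ≠ 0) (hμ : 0 < μ)
    (hU : ∀ p ∈ U, 0 < p.2 ∧ G a μ p.2 ≠ 0) {h : Tensor2} {u v w : smoothFn U} (H : ∀ i j, Rep (h i j) (realMode u v w i j))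
    (hvac : ∀ x ∈ chart U, linRicci a μ h 2 4 x = 0) {x : Coord} (hx : x ∈ chart U) :
    master a μ (symOp a μ h) x
      = Complex.I * a * pd 0 (master a μ h) x + 6 * master a μ h x := by
  have HZ : ∀ i j, Rep (symOp a μ h i j) _ := fun i j =>
    (rep_symOp ha hμ hU H i j).of_eq (sym_realMode ha hμ hU u v w i j)
  have Z0 : Rep (symOp a μ h 0 2) ((background ha hμ hU).symT u v w) := HZ 0 2
  have Z1 : Rep (symOp a μ h 1 2) ((background ha hμ hU).symR u v w) := HZ 1 2
  have Z4 : Rep (symOp a μ h 2 4) ((background ha hμ hU).sym3 u v w) := HZ 2 4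
  have H0 : Rep (h 0 2) u := H 0 2
  have H1 : Rep (h 1 2) v := H 1 2
  have H4 : Rep (h 2 4) w := H 2 4
  have M := rep_master ha hμ hU H0 H1 H4
  have MZ := rep_master ha hμ hU Z0 Z1 Z4
  have hE : ((background ha hμ hU).twoRicci (realMode u v w) 2 4).1 ⟨(x 0, x 1), hx.1⟩ = 0 := by
    have R := rep_linRicci ha hμ hU H 2 4
    generalize (background ha hμ hU).twoRicci (realMode u v w) 2 4 = e at R ⊢
    have h0 : 0 = (1 / 2 : ℂ) * e.1 ⟨(x 0, x 1), hx.1⟩ := (hvac x hx).symm.trans (R x hx)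
    linear_combination -2 * h0
  have d : (background ha hμ hU).dt (masterFn a hμ fun p hp => (hU p hp).1) = 0 :=
    der_masterFn a hμ _
  rw [realMode] at hE
  have key := (background ha hμ hU).mom_symmetry u v w (conj u) (conj v) (conj w)
  -- By Leibniz, `∂_t` passes through the master factor, whose `t`-derivative is zero by `d`.
  rw [MZ x hx, M x hx, M.pd 0 x hx, frameA_zero ha hμ hU, Derivation.leibniz, d, key]
  generalize (background ha hμ hU).mom ((background ha hμ hU).fieldT u w)
    ((background ha hμ hU).fieldR v w) = f
  generalize (background ha hμ hU).twoRicci _ 2 4 = e at hE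
  simp [hE, ofNat_apply, background_i_apply, background_a_apply]
  ring

end MyersPerry

end

theorem mainTheorem4 (a μ : ℝ) (ha : a ≠ 0) (hμ : 0 < μ)
    (U : Set (ℝ × ℝ)) (hU : IsOpen U)
    (hdom : ∀ p ∈ U, 0 < p.2 ∧ MyersPerry.G a μ p.2 ≠ 0)
    (h : MyersPerry.Tensor2)
    (hmode : MyersPerry.IsMode010 U h)
    (hvac : MyersPerry.IsLinearVacuum a μ U h) :
    MyersPerry.IsMode010 U (MyersPerry.symOp a μ h) ∧
    (∀ x ∈ MyersPerry.chart U,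
      MyersPerry.master a μ (MyersPerry.symOp a μ h) x
        = Complex.I * a * MyersPerry.pd 0 (MyersPerry.master a μ h) x
          + 6 * MyersPerry.master a μ h x) ∧
    (∀ (ω : ℂ) (φ : ℝ → ℂ),
      (∀ x ∈ MyersPerry.chart U,
        MyersPerry.master a μ h x = Complex.exp (-Complex.I * ω * x 0) * φ (x 1)) →
      ∀ x ∈ MyersPerry.chart U,
        MyersPerry.master a μ (MyersPerry.symOp a μ h) x
          = (a * ω + 6) * MyersPerry.master a μ h x ∧
        MyersPerry.master a μ (MyersPerry.symOp a μ h) x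
          = ((a * ω.re + 6) * Complex.exp (-Complex.I * (ω.re * x 0))
              + a * ω.im * Complex.exp (-Complex.I * (ω.re * x 0 - Real.pi / 2)))
            * Complex.exp (ω.im * x 0) * φ (x 1)) := by
  open MyersPerry in
  lift U to TopologicalSpace.Opens (ℝ × ℝ) using hU
  obtain ⟨u, v, w, H⟩ := isMode010_iff.1 hmode
  have key : ∀ x ∈ chart U, master a μ (symOp a μ h) x
      = Complex.I * a * pd 0 (master a μ h) x + 6 * master a μ h x := fun x hx =>
    master_symOp ha hμ hdom H (fun x hx => hvac x hx 2 4) hx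
  refine ⟨isMode010_iff.2 ⟨_, _, _, fun i j => (rep_symOp ha hμ hdom H i j).of_eq
    (sym_realMode ha hμ hdom u v w i j)⟩, key, fun ω φ hφ x hx => ?_⟩
  have h1 : master a μ (symOp a μ h) x = (a * ω + 6) * master a μ h x := by
    rw [key x hx, (rep_master ha hμ hdom (H 0 2) (H 1 2) (H 2 4)).pd_zero_of_eq_exp hφ hx]
    -- On this time dependence `i a ∂_t` acts as `i a · (-i ω) = a ω`.
    linear_combination (-(a * ω * master a μ h x)) * Complex.I_sq
  refine ⟨h1, ?_⟩
  have e1 : Complex.exp (-Complex.I * ω * x 0)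
      = Complex.exp (-Complex.I * (ω.re * x 0)) * Complex.exp (ω.im * x 0) := by
    rw [← Complex.exp_add]
    congr 1
    nth_rewrite 1 [← Complex.re_add_im ω]
    linear_combination (-(ω.im * x 0 : ℂ)) * Complex.I_sq
  -- The phase shift by `π/2` is multiplication by `i`, which accounts for the summand `i a Im ω` of
  -- `a ω`.
  have e2 : Complex.exp (-Complex.I * (ω.re * x 0 - Real.pi / 2))
      = Complex.exp (-Complex.I * (ω.re * x 0)) * Complex.I := by
    rw [show -Complex.I * (ω.re * x 0 - Real.pi / 2)
      = -Complex.I * (ω.re * x 0) + Real.pi / 2 * Complex.I by ring, Complex.exp_add,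
      Complex.exp_pi_div_two_mul_I]
  rw [h1, hφ x hx, e1, e2]
  nth_rewrite 1 [← Complex.re_add_im ω]
  ring
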